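/- **Setting.** Let $\mathcal T_*$ be the category of pointed connected compactly generated spaces and $\mathrm{ho}\,\mathcal T_*$ its homotopy category (pointed homotopy classes of pointed maps). A *lattice* $\Gamma$ is a finite directed category, regarded as non-unital (so $\Gamma(v,v)=\emptyset$ for all $v$), with objects $v_{\mathrm{init}},v_{\mathrm{fin}}$ such that every $w\ne v_{\mathrm{init}}$ receives an arrow from $v_{\mathrm{init}}$, every $w\neq v_{\mathrm{fin}}$ has an arrow to $v_{\mathrm{fin}}$, there is exactly one arrow $\phi_{\max}:v_{\mathrm{init}}\to v_{\mathrm{fin}}$, and there is an object different from $v_{\mathrm{init}}$ and $v_{\mathrm{fin}}$. *Initial data* is a functor $\mathcal A:\Gamma\to\mathrm{ho}\,\mathcal T_*$. The topological category $W\Gamma$ has the objects of $\Gamma$ and morphism spaces $W\Gamma(u,v)=\bigsqcup_{n\ge0}\Gamma_{n+1}(u,v)\times I^n/\!\sim$, where $\Gamma_{n+1}(u,v)$ is the discrete set of chains of $n+1$ composable arrows from $u$ to $v$, the $n$ coordinates are attached to the internal nodes of the chain, and $\sim$ composes the two arrows at any internal node with coordinate $0$; composition is concatenation with coordinate $1$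 at the new node. A chain $\Phi$ of $n+1$ arrows defines an $n$-cube $C[\Phi]$; its faces of dimension $\le k$ consist of the points with at most $k$ coordinates different from $0,1$. The subcategory $bW\Gamma$ has $bW\Gamma(u,v)=W\Gamma(u,v)$ for $(u,v)\ne(v_{\mathrm{init}},v_{\mathrm{fin}})$, while $bW\Gamma(v_{\mathrm{init}},v_{\mathrm{fin}})$ consists of the decomposable morphisms; $\mathrm{sk}_k\,bW\Gamma$ is the subcategory generated by its faces of dimension $\le k$. An *$n$-realization* of $\mathcal A$ is a continuous functor $\bar{\mathcal A}_n:\mathrm{sk}_n\,bW\Gamma\to\mathcal T_*$ with $\bar{\mathcal A}_n(v)=\mathcal A(v)$ for every object $v$ and $[\bar{\mathcal A}_n(f)]=\mathcal A(f)$ for every arrow $f\neq\phi_{\max}$ of $\Gamma$. For $n\ge 1$, an *indecomposable $n$-cube* of $bW\Gamma$ is given by a chain $\Psi$ of $n+1$ arrows of $\Gamma$ that does not run from $v_{\mathrm{init}}$ to $v_{\mathrm{fin}}$; $\Gamma_\Psi\subset\Gamma$ denotes the sublattice generated by the arrows of $\Psi$, and $W\Gamma_\Psi\subset W\Gamma$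 its $W$-construction. A *common $k$-face* of two distinct indecomposable $(k+1)$-cubes $\Psi,\Psi'$ is an indecomposable $k$-cube $\chi$ all of whose arrows lie in both $\Gamma_\Psi$ and $\Gamma_{\Psi'}$. For a $k$-cube $C$ and pointed spaces $X,Y$, two maps $F_1,F_2:X\rtimes C\to Y$ agreeing with $f$ on $X\rtimes\partial C$ define a map $D_{F_1,F_2}:X\rtimes(C\cup_{\partial C}C)\to Y$, where $C\cup_{\partial C}C\cong\Sigma\partial C$ and $X\rtimes K=(X\times K)/(\{*\}\times K)$. Its homotopy class $\delta_f(F_1,F_2)$ relative to $X\rtimes\partial C$ is the *difference obstruction*. It is *null* if $D_{F_1,F_2}$, as a map from $\Sigma\partial C$ to the space of pointed maps $X\to Y$, is homotopic to a constant map. Given $k\geq1$ and a $(k-1)$-realization $\bar{\mathcal A}_{k-1}$, suppose that for each indecomposable $(k+1)$-cube $\Psi$ a continuous functor $F_\Psi:W\Gamma_\Psi\to\mathcal T_*$ is chosen that agrees with $\bar{\mathcal A}_{k-1}$ on $\mathrm{sk}_{k-1}W\Gamma_\Psi$. The *obstruction sequence* of $\bar{\mathcal A}_{k-1}$ determined by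 $(F_\Psi)_\Psi$ is the family of the difference obstructions $\delta_{\bar{\mathcal A}_{k-1}}(F_\Psi|_{C[\chi]},F_{\Psi'}|_{C[\chi]})$, indexed by all pairs $\Psi\ne\Psi'$ of indecomposable $(k+1)$-cubes and all their common $k$-faces $\chi$; here $X=\mathcal A(x)$ and $Y=\mathcal A(y)$ if $\chi$ runs from $x$ to $y$. It *vanishes* if each of its components is null. **Theorem.** Let $\mathcal A:\Gamma\to\mathrm{ho}\,\mathcal T_*$ be initial data, let $k\ge1$, and let $\bar{\mathcal A}_{k-1}:\mathrm{sk}_{k-1}\,bW\Gamma\to\mathcal T_*$ be a $(k-1)$-realization of $\mathcal A$ that can be extended to a $k$-realization. Then $\bar{\mathcal A}_{k-1}$ can be extended to a $(k+1)$-realization if and only if it has some vanishing obstruction sequence. -/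

import Mathlib

universe u v w

noncomputable section

open Topology
open scoped unitInterval

namespace HHO

/-! ## Pointed spaces and their homotopy category -/

/-- An object of `T_*`: a pointed connected compactly generated space. -/
structure PointedSpace where
  carrier : Type w
  [top : TopologicalSpace carrier]
  [compactlyGenerated : CompactlyGeneratedSpace carrier]
  [connected : ConnectedSpace carrier]
  pt : carrier

instance : CoeSort PointedSpace.{w} (Type w) := ⟨PointedSpace.carrier⟩

instance (X : PointedSpace.{w}) : TopologicalSpace X := X.top

/-- Morphisms of `T_*`: continuous maps preserving the base point. -/
abbrev PMap (X Y : PointedSpace.{w}) := {f : C(X, Y) // f X.pt = Y.pt}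

/-- Composition in diagrammatic order. -/
def PMap.comp {X Y Z : PointedSpace.{w}} (f : PMap X Y) (g : PMap Y Z) : PMap X Z :=
  ⟨g.1.comp f.1, by simp [f.2, g.2]⟩

/-- Two pointed maps are identified if they are homotopic relative to the base point. -/
instance PMap.setoid (X Y : PointedSpace.{w}) : Setoid (PMap X Y) where
  r f g := ContinuousMap.HomotopicRel f.1 g.1 {X.pt}
  iseqv := ⟨fun f => .refl f.1, fun h => h.symm, fun h h' => h.trans h'⟩

/-- Morphisms of `ho T_*`: pointed homotopy classes of pointed maps. -/
def HoMap (X Y : PointedSpace.{w}) := Quotient (PMap.setoid X Y)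

theorem PMap.comp_homotopic {X Y Z : PointedSpace.{w}} {f f' : PMap X Y} {g g' : PMap Y Z}
    (hf : f ≈ f') (hg : g ≈ g') : f.comp g ≈ f'.comp g' := by
  obtain ⟨H⟩ := hf
  obtain ⟨K⟩ := hg
  refine ⟨⟨K.toHomotopy.comp H.toHomotopy, ?_⟩⟩
  rintro t x rfl
  have h1 : H (t, X.pt) = Y.pt := (H.eq_fst t rfl).trans f.2
  have h2 : K (t, Y.pt) = Z.pt := (K.eq_fst t rfl).trans g.2
  change K (t, H (t, X.pt)) = g.1 (f.1 X.pt)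
  rw [h1, h2, f.2, g.2]

/-- Composition in `ho T_*`, in diagrammatic order. -/
def HoMap.comp {X Y Z : PointedSpace.{w}} : HoMap X Y → HoMap Y Z → HoMap X Z :=
  Quotient.map₂ PMap.comp fun _ _ hf _ _ hg => PMap.comp_homotopic hf hg

/-! ## Lattices and initial data -/

/-- A lattice: a finite directed category with a weak initial object, a weak terminal object, a
unique (maximal) arrow between the two, and at least one further object.  Since a directed category
has no loops, identities are omitted, so that `Hom x x` is empty. -/
structure LatticeCat where
  V : Type u
  [finV : Finite V]
  Hom : V → V → Type v
  [finHom : ∀ x y, Finite (Hom x y)]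
  /-- Composition, in diagrammatic order. -/
  comp : ∀ {x y z}, Hom x y → Hom y z → Hom x z
  assoc : ∀ {x y z t} (f : Hom x y) (g : Hom y z) (h : Hom z t),
    comp (comp f g) h = comp f (comp g h)
  directed : ∀ x, IsEmpty (Hom x x)
  vinit : V
  vfin : V
  weak_initial : ∀ x, x ≠ vinit → Nonempty (Hom vinit x)
  weak_terminal : ∀ x, x ≠ vfin → Nonempty (Hom x vfin)
  /-- The unique arrow from `vinit` to `vfin`. -/
  phiMax : Hom vinit vfin
  eq_phiMax : ∀ f : Hom vinit vfin, f = phiMax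
  nontrivial : ∃ x, x ≠ vinit ∧ x ≠ vfin

/-- Initial data: a functor from a lattice to `ho T_*`. -/
structure InitialData (Γ : LatticeCat.{u, v}) where
  obj : Γ.V → PointedSpace.{w}
  map : ∀ {x y}, Γ.Hom x y → HoMap (obj x) (obj y)
  map_comp : ∀ {x y z} (f : Γ.Hom x y) (g : Γ.Hom y z),
    map (Γ.comp f g) = (map f).comp (map g)

variable {Γ : LatticeCat.{u, v}}

/-! ## The W-construction -/

/-- Nonempty chains of composable arrows, listed from the source to the target. -/
inductive Chain (Γ : LatticeCat.{u, v}) : Γ.V → Γ.V → Type (max u v)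
  | single {x y : Γ.V} (f : Γ.Hom x y) : Chain Γ x y
  | cons {x y z : Γ.V} (f : Γ.Hom x y) (c : Chain Γ y z) : Chain Γ x z

/-- The dimension of the cube of a chain, i.e. the number of internal nodes: a chain of `n + 1`
arrows has dimension `n`. -/
def Chain.dim : ∀ {x y : Γ.V}, Chain Γ x y → ℕ
  | _, _, .single _ => 0
  | _, _, .cons _ c => c.dim + 1

/-- The arrows of a chain, together with their end points. -/
def Chain.arrows : ∀ {x y : Γ.V}, Chain Γ x y → List (Σ a b : Γ.V, Γ.Hom a b)
  | _, _, .single f => [⟨_, _, f⟩]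
  | _, _, .cons f c => ⟨_, _, f⟩ :: c.arrows

/-- The points of the disjoint union of the spaces `Γ_{n+1}(x,y) × I^n`: chains
with a parameter `t ∈ I` attached to each internal node. -/
inductive WPt (Γ : LatticeCat.{u, v}) : Γ.V → Γ.V → Type (max u v)
  | single {x y : Γ.V} (f : Γ.Hom x y) : WPt Γ x y
  | cons {x y z : Γ.V} (f : Γ.Hom x y) (t : I) (p : WPt Γ y z) : WPt Γ x z

/-- The inclusion of the summand `{c} × I^n`. -/
def WPt.mk : ∀ {x y : Γ.V} (c : Chain Γ x y), (Fin c.dim → I) → WPt Γ x y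
  | _, _, .single f, _ => .single f
  | _, _, .cons f c, t => .cons f (t (0 : Fin (c.dim + 1))) (WPt.mk c (Fin.tail (n := c.dim) t))

/-- The disjoint union topology. -/
instance (x y : Γ.V) : TopologicalSpace (WPt Γ x y) :=
  ⨆ c : Chain Γ x y, TopologicalSpace.coinduced (WPt.mk c) inferInstance

/-- The underlying arrows of a chain with parameters. -/
def WPt.arrows : ∀ {x y : Γ.V}, WPt Γ x y → List (Σ a b : Γ.V, Γ.Hom a b)
  | _, _, .single f => [⟨_, _, f⟩]
  | _, _, .cons f _ p => ⟨_, _, f⟩ :: p.arrows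

/-- The relation that composes the two arrows at an internal node with parameter `0`. -/
inductive WPt.Rel : ∀ {x y : Γ.V}, WPt Γ x y → WPt Γ x y → Prop
  | last {x y z : Γ.V} (f : Γ.Hom x y) (g : Γ.Hom y z) :
      WPt.Rel (.cons f 0 (.single g)) (.single (Γ.comp f g))
  | inner {x y z s : Γ.V} (f : Γ.Hom x y) (g : Γ.Hom y z) (t : I) (p : WPt Γ z s) :
      WPt.Rel (.cons f 0 (.cons g t p)) (.cons (Γ.comp f g) t p)
  | tail {x y z : Γ.V} (f : Γ.Hom x y) (t : I) {p q : WPt Γ y z} :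
      WPt.Rel p q → WPt.Rel (.cons f t p) (.cons f t q)

/-- The space of morphisms `WΓ(x,y)`, with the quotient topology. -/
def W (Γ : LatticeCat.{u, v}) (x y : Γ.V) := Quot (WPt.Rel (Γ := Γ) (x := x) (y := y))

instance (x y : Γ.V) : TopologicalSpace (W Γ x y) :=
  inferInstanceAs (TopologicalSpace (Quot (WPt.Rel (Γ := Γ) (x := x) (y := y))))

/-- The characteristic map of the cube `C[c]`. -/
def W.cube {x y : Γ.V} (c : Chain Γ x y) (t : Fin c.dim → I) : W Γ x y :=
  Quot.mk _ (WPt.mk c t)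

/-- The image in `WΓ` of an arrow of `Γ`. -/
def W.arrow {x y : Γ.V} (f : Γ.Hom x y) : W Γ x y := Quot.mk _ (.single f)

/-- Concatenation, with parameter `1` at the new internal node. -/
def WPt.append : ∀ {x y z : Γ.V}, WPt Γ x y → WPt Γ y z → WPt Γ x z
  | _, _, _, .single f, q => .cons f 1 q
  | _, _, _, .cons f t p, q => .cons f t (p.append q)

theorem WPt.Rel.append_left {x y z : Γ.V} {p p' : WPt Γ x y} (h : WPt.Rel p p')
    (q : WPt Γ y z) : WPt.Rel (p.append q) (p'.append q) := by
  induction h with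
  | last f g => exact .inner f g 1 q
  | inner f g t p => exact .inner f g t (p.append q)
  | tail f t _ ih => exact .tail f t (ih q)

theorem WPt.Rel.append_right {x y z : Γ.V} (p : WPt Γ x y) {q q' : WPt Γ y z}
    (h : WPt.Rel q q') : WPt.Rel (p.append q) (p.append q') := by
  induction p with
  | single f => exact .tail f 1 h
  | cons f t p ih => exact .tail f t (ih h)

/-- Composition in `WΓ`, in diagrammatic order. -/
def W.comp {x y z : Γ.V} : W Γ x y → W Γ y z → W Γ x z :=
  Quot.map₂ WPt.append (fun p _ _ h => WPt.Rel.append_right p h)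
    (fun _ _ q h => WPt.Rel.append_left h q)

/-- A (non-unital) subcategory of `WΓ` on all objects; its morphism spaces carry the subspace
topology. -/
structure Subcat (Γ : LatticeCat.{u, v}) where
  mor : ∀ x y : Γ.V, Set (W Γ x y)
  comp_mem : ∀ {x y z : Γ.V} {a : W Γ x y} {b : W Γ y z},
    a ∈ mor x y → b ∈ mor y z → a.comp b ∈ mor x z

/-- The morphisms of `bWΓ`: all morphisms of `WΓ(x,y)` if `(x,y) ≠ (vinit,vfin)`, and the
decomposable ones otherwise. -/
def IsBasic {x y : Γ.V} (a : W Γ x y) : Prop :=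
  ¬ (x = Γ.vinit ∧ y = Γ.vfin) ∨
    ∃ z : Γ.V, z ≠ Γ.vinit ∧ z ≠ Γ.vfin ∧ ∃ (b : W Γ x z) (c : W Γ z y), a = b.comp c

/-- The point lies on a face of dimension at most `k` of `C[c]` for some chain `c`: at most `k`
of its coordinates are different from `0` and `1`. -/
def InFace (k : ℕ) {x y : Γ.V} (a : W Γ x y) : Prop :=
  ∃ (c : Chain Γ x y) (t : Fin c.dim → I),
    a = W.cube c t ∧ {i | t i ≠ 0 ∧ t i ≠ 1}.ncard ≤ k

/-- The morphisms generated by the points of `bWΓ` on faces of dimension at most `k`. -/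
inductive InSkeleton (k : ℕ) : ∀ {x y : Γ.V}, W Γ x y → Prop
  | face {x y : Γ.V} (a : W Γ x y) : IsBasic a → InFace k a → InSkeleton k a
  | comp {x y z : Γ.V} (a : W Γ x y) (b : W Γ y z) :
      InSkeleton k a → InSkeleton k b → InSkeleton k (a.comp b)

/-- The `k`-skeleton of `bWΓ`. -/
def skeleton (Γ : LatticeCat.{u, v}) (k : ℕ) : Subcat Γ where
  mor _ _ := {a | InSkeleton k a}
  comp_mem := .comp _ _

theorem arrow_mem_skeleton (k : ℕ) {x y : Γ.V} (h : ¬ (x = Γ.vinit ∧ y = Γ.vfin))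
    (f : Γ.Hom x y) : W.arrow f ∈ (skeleton Γ k).mor x y := by
  refine .face _ (.inl h) ⟨.single f, Fin.elim0, rfl, ?_⟩
  have : {i : Fin (Chain.single f).dim | (Fin.elim0 i : I) ≠ 0 ∧ (Fin.elim0 i : I) ≠ 1} = ∅ :=
    Set.eq_empty_of_forall_notMem fun i => i.elim0
  rw [this, Set.ncard_empty]
  exact k.zero_le

/-! ## Continuous functors and realizations -/

/-- A continuous functor to `T_*` from a subcategory of `WΓ`, with prescribed values `X` on objects.
Continuity of `U(x,y) → T_*(X x, X y)` is expressed by continuity of the adjoint map. -/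
structure CFunctor (X : Γ.V → PointedSpace.{w}) (U : Subcat Γ) where
  map : ∀ {x y : Γ.V}, U.mor x y → X x → X y
  continuous_map : ∀ x y : Γ.V, Continuous fun p : X x × U.mor x y => map p.2 p.1
  map_pt : ∀ {x y : Γ.V} (a : U.mor x y), map a (X x).pt = (X y).pt
  map_comp : ∀ {x y z : Γ.V} (a : U.mor x y) (b : U.mor y z) (s : X x),
    map ⟨a.1.comp b.1, U.comp_mem a.2 b.2⟩ s = map b (map a s)

/-- The value of a functor on a morphism, as a morphism of `T_*`. -/
def CFunctor.pmap {X : Γ.V → PointedSpace.{w}} {U : Subcat Γ} (F : CFunctor X U) {x y : Γ.V}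
    (a : U.mor x y) : PMap (X x) (X y) :=
  ⟨⟨F.map a, (F.continuous_map x y).comp (Continuous.prodMk_left a)⟩, F.map_pt a⟩

/-- Two functors with the same values on objects agree on all common morphisms. -/
def CFunctor.Agree {X : Γ.V → PointedSpace.{w}} {U U' : Subcat Γ} (F : CFunctor X U)
    (G : CFunctor X U') : Prop :=
  ∀ (x y : Γ.V) (a : W Γ x y) (h : a ∈ U.mor x y) (h' : a ∈ U'.mor x y),
    F.map ⟨a, h⟩ = G.map ⟨a, h'⟩

/-- An `n`-realization of initial data: a functor on the `n`-skeleton of `bWΓ` which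
represents the given homotopy class on each arrow of `Γ` except the maximal one. -/
structure Realization (A : InitialData.{u, v, w} Γ) (n : ℕ) where
  toFunctor : CFunctor A.obj (skeleton Γ n)
  class_eq : ∀ {x y : Γ.V} (h : ¬ (x = Γ.vinit ∧ y = Γ.vfin)) (f : Γ.Hom x y),
    (Quotient.mk _ (toFunctor.pmap ⟨W.arrow f, arrow_mem_skeleton n h f⟩) :
      HoMap (A.obj x) (A.obj y)) = A.map f

/-- `R'` extends `R`. -/
def Realization.Extends {A : InitialData.{u, v, w} Γ} {m n : ℕ} (R' : Realization A n)
    (R : Realization A m) : Prop :=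
  m ≤ n ∧ R'.toFunctor.Agree R.toFunctor

/-! ## Difference obstructions -/

section Difference

variable (X Y : PointedSpace.{w})

/-- Pointed maps `X ⋊ K → Y`, where `X ⋊ K = (X × K)/({pt} × K)`. -/
abbrev HalfSmashMap (K : Type) [TopologicalSpace K] :=
  {f : C(X × K, Y) // ∀ s : K, f (X.pt, s) = Y.pt}

/-- The relation on two copies of `C` that identifies the two copies of `B ⊆ C`. -/
inductive DoubleRel {C : Type} (B : Set C) : C × Bool → C × Bool → Prop
  | glue (c : C) (h : c ∈ B) : DoubleRel B (c, true) (c, false)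

/-- Two copies of `C` glued along `B`. For a cube and its boundary this is `Σ∂C`. -/
def Double {C : Type} (B : Set C) : Type := Quot (DoubleRel B)

instance {C : Type} [TopologicalSpace C] (B : Set C) : TopologicalSpace (Double B) :=
  inferInstanceAs (TopologicalSpace (Quot (DoubleRel B)))

/-- The projection from the two copies of `C`. -/
def Double.mk {C : Type} (B : Set C) (p : C × Bool) : Double B := Quot.mk _ p

/-- Maps out of the double. -/
def Double.lift {C : Type} {B : Set C} {Z : Type w} (f : C × Bool → Z)
    (h : ∀ c ∈ B, f (c, true) = f (c, false)) (d : Double B) : Z :=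
  Quot.lift f (by rintro _ _ ⟨c, hc⟩; exact h c hc) d

/-- The copy of `B` in the double. -/
def Double.base {C : Type} (B : Set C) : Set (Double B) :=
  {d | ∃ c ∈ B, d = Double.mk B (c, true)}

theorem Double.isProperMap_mk {C : Type} [TopologicalSpace C] [CompactSpace C] [T2Space C]
    {B : Set C} (hB : IsClosed B) :
    IsProperMap (Double.mk B) := by
  have hq : IsQuotientMap (Double.mk B) := isQuotientMap_quot_mk
  let fold : Double B → C := Quot.lift Prod.fst (by rintro _ _ ⟨c, h⟩; rfl)
  have hrel : ∀ p q : C × Bool, Double.mk B p = Double.mk B q →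
      p = q ∨ (p.1 = q.1 ∧ p.1 ∈ B) := by
    intro p q h
    have h1 : p.1 = q.1 := congrArg fold h
    by_cases hp : p.1 ∈ B
    · exact .inr ⟨h1, hp⟩
    · left
      let g : Double B → Prop := Quot.lift (fun r => r.1 ∈ B ∨ r.2 = true) (by
        rintro _ _ ⟨c, h⟩; simp [h])
      have h2 : (p.1 ∈ B ∨ p.2 = true) = (q.1 ∈ B ∨ q.2 = true) := congrArg g h
      rw [← h1] at h2
      simp only [hp, false_or, eq_iff_iff] at h2
      exact Prod.ext h1 (Bool.eq_iff_iff.2 h2)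
  have hsat : ∀ S : Set (C × Bool), (Double.mk B) ⁻¹'
      ((Double.mk B) '' S) =
        S ∪ Prod.fst ⁻¹' (B ∩ Prod.fst '' S) := by
    intro S
    ext q
    constructor
    · rintro ⟨p, hp, h⟩
      rcases hrel p q h with rfl | ⟨h1, h2⟩
      · exact .inl hp
      · exact .inr ⟨h1 ▸ h2, p, hp, h1⟩
    · rintro (h | ⟨h1, ⟨c, b⟩, hp, h2⟩)
      · exact ⟨q, h, rfl⟩
      · obtain ⟨d, b'⟩ := q
        change c = d at h2
        subst h2
        refine ⟨_, hp, ?_⟩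
        have : Double.mk B (c, true) = Double.mk B (c, false) := Quot.sound (.glue c h1)
        cases b <;> cases b' <;> simp [this]
  have hclosed : IsClosedMap (Double.mk B) := by
    intro S hS
    rw [← hq.isClosed_preimage, hsat]
    exact hS.union ((hB.inter (hS.isCompact.image continuous_fst).isClosed).preimage
      continuous_fst)
  refine isProperMap_iff_isClosedMap_and_compact_fibers.2 ⟨hq.continuous, hclosed, ?_⟩
  rintro ⟨p⟩
  have := hclosed {p} isClosed_singleton
  rw [Set.image_singleton] at this
  exact (this.preimage hq.continuous).isCompact

/-- The map `D : X ⋊ (C ∪_B C) → Y` defined by two maps `X ⋊ C → Y` that agree on `X ⋊ B`. -/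
def differenceMap {C : Type} [TopologicalSpace C] [CompactSpace C] [T2Space C] {B : Set C}
    (hB : IsClosed B) (F₁ F₂ : HalfSmashMap X Y C)
    (h : ∀ (s : X), ∀ c ∈ B, F₁.1 (s, c) = F₂.1 (s, c)) : HalfSmashMap X Y (Double B) where
  val :=
    { toFun := fun p => Double.lift
        (fun q : C × Bool => bif q.2 then F₁.1 (p.1, q.1) else F₂.1 (p.1, q.1)) (h p.1) p.2
      continuous_toFun := by
        have hq : IsQuotientMap (Prod.map (id : X → X)
            (Double.mk B)) :=
          (IsProperMap.prodMap isProperMap_id (Double.isProperMap_mk hB)).isClosedMap.isQuotientMap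
            (continuous_id.prodMap (Double.isProperMap_mk hB).continuous)
            (Function.surjective_id.prodMap Quot.mk_surjective)
        rw [hq.continuous_iff]
        have : Continuous fun p : (X × C) × Bool => bif p.2 then F₁.1 p.1 else F₂.1 p.1 :=
          continuous_prod_of_discrete_right.2 (by
            rintro (_ | _)
            · exact F₂.1.continuous
            · exact F₁.1.continuous)
        exact this.comp (f := fun p : X × (C × Bool) => ((p.1, p.2.1), p.2.2)) (by fun_prop) }
  property := by
    rintro ⟨c, _ | _⟩
    · exact F₂.2 c
    · exact F₁.2 c

/-- Homotopy of maps `X ⋊ (C ∪_B C) → Y` relative to `X ⋊ B`. -/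
def relSetoid {C : Type} [TopologicalSpace C] (B : Set C) :
    Setoid (HalfSmashMap X Y (Double B)) where
  r f g := ContinuousMap.HomotopicRel f.1 g.1 {p | p.1 = X.pt ∨ p.2 ∈ Double.base B}
  iseqv := ⟨fun f => .refl f.1, fun h => h.symm, fun h h' => h.trans h'⟩

/-- The set `[X ⋊ (C ∪_B C), Y (rel X ⋊ B)]`. -/
def DifferenceClass {C : Type} [TopologicalSpace C] (B : Set C) := Quotient (relSetoid X Y B)

variable {X Y}

/-- A map `X ⋊ K → Y` is null if, as a map from `K` to the space of pointed maps `X → Y`, it is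
homotopic to a constant map. -/
def HalfSmashMap.IsNull {K : Type} [TopologicalSpace K] (f : HalfSmashMap X Y K) : Prop :=
  ∃ g : PMap X Y, ContinuousMap.HomotopicRel f.1 (g.1.comp ContinuousMap.fst) {p | p.1 = X.pt}

/-- A class is null if its representatives are null; this does not depend on the representative. -/
def DifferenceClass.IsNull {C : Type} [TopologicalSpace C] {B : Set C}
    (δ : DifferenceClass X Y B) : Prop :=
  Quotient.lift (s := relSetoid X Y B) HalfSmashMap.IsNull (by
    have key : ∀ f g : HalfSmashMap X Y (Double B), (relSetoid X Y B).r f g →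
        f.IsNull → g.IsNull := by
      rintro f g ⟨H⟩ ⟨e, he⟩
      have H' : ContinuousMap.HomotopicRel f.1 g.1 {p | p.1 = X.pt} :=
        ⟨⟨H.toHomotopy, fun t x hx => H.prop' t x (.inl hx)⟩⟩
      exact ⟨e, H'.symm.trans he⟩
    intro f g h
    exact propext ⟨key f g h, key g f ((relSetoid X Y B).symm h)⟩) δ

/-- The boundary of the cube `I^n`. -/
def cubeBoundary (n : ℕ) : Set (Fin n → I) := {t | ∃ i, t i = 0 ∨ t i = 1}

theorem isClosed_cubeBoundary (n : ℕ) : IsClosed (cubeBoundary n) := by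
  have : cubeBoundary n = ⋃ i, {t : Fin n → I | t i = 0} ∪ {t | t i = 1} := by
    ext t; simp [cubeBoundary]
  rw [this]
  exact isClosed_iUnion_of_finite fun i =>
    (isClosed_eq (continuous_apply i) continuous_const).union
      (isClosed_eq (continuous_apply i) continuous_const)

/-- The difference obstruction of two maps on `X ⋊ I^n` that agree on `X ⋊ ∂I^n`. -/
def differenceObstruction {n : ℕ} (F₁ F₂ : HalfSmashMap X Y (Fin n → I))
    (h : ∀ (s : X), ∀ t ∈ cubeBoundary n, F₁.1 (s, t) = F₂.1 (s, t)) :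
    DifferenceClass X Y (cubeBoundary n) :=
  Quotient.mk _ (differenceMap X Y (isClosed_cubeBoundary n) F₁ F₂ h)

end Difference

/-! ## Obstruction sequences -/

/-- An indecomposable `n`-cube of `bWΓ`, given by its only factor `C[Ψ]` of positive dimension:
`Ψ` is a chain of `n + 1` arrows which does not run from `vinit` to `vfin`. -/
structure IndecCube (Γ : LatticeCat.{u, v}) (n : ℕ) where
  src : Γ.V
  tgt : Γ.V
  chain : Chain Γ src tgt
  dim_eq : chain.dim = n
  proper : ¬ (src = Γ.vinit ∧ tgt = Γ.vfin)

/-- The arrows of the sublattice of `Γ` generated by the arrows of a chain `Ψ`. -/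
inductive Generated {x y : Γ.V} (Ψ : Chain Γ x y) : ∀ {a b : Γ.V}, Γ.Hom a b → Prop
  | of {a b : Γ.V} (f : Γ.Hom a b) : ⟨a, b, f⟩ ∈ Ψ.arrows → Generated Ψ f
  | comp {a b c : Γ.V} (f : Γ.Hom a b) (g : Γ.Hom b c) :
      Generated Ψ f → Generated Ψ g → Generated Ψ (Γ.comp f g)

theorem WPt.arrows_append {x y z : Γ.V} (p : WPt Γ x y) (q : WPt Γ y z) :
    (p.append q).arrows = p.arrows ++ q.arrows := by
  induction p with
  | single f => rfl
  | cons f t p ih => simp [WPt.append, WPt.arrows, ih q]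

theorem WPt.arrows_mk {x y : Γ.V} (c : Chain Γ x y) (t : Fin c.dim → I) :
    (WPt.mk c t).arrows = c.arrows := by
  induction c with
  | single f => rfl
  | cons f c ih => simp [WPt.mk, WPt.arrows, Chain.arrows, ih]

/-- The subcategory `WΓ'` of `WΓ`, where `Γ'` is the sublattice generated by the arrows of `Ψ`. -/
def subW {x y : Γ.V} (Ψ : Chain Γ x y) : Subcat Γ where
  mor _ _ := {a | ∃ p, a = Quot.mk _ p ∧ ∀ f ∈ p.arrows, Generated Ψ f.2.2}
  comp_mem := by
    rintro _ _ _ _ _ ⟨p, rfl, hp⟩ ⟨q, rfl, hq⟩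
    refine ⟨p.append q, rfl, fun f hf => ?_⟩
    rw [WPt.arrows_append, List.mem_append] at hf
    exact hf.elim (hp f) (hq f)

/-- The chain `χ` lies in the sublattice `Γ'` generated by `Ψ`, i.e. `C[χ]` is a cube of `WΓ'`. For
`χ` with one arrow less than `Ψ` this says that `C[χ]` is a facet of `C[Ψ]`, up to the
zero-dimensional factor split off in a facet on which the first or the last parameter is `1`. -/
def IsSubchain {x y a b : Γ.V} (χ : Chain Γ a b) (Ψ : Chain Γ x y) : Prop :=
  ∀ f ∈ χ.arrows, Generated Ψ f.2.2

theorem cube_mem_subW {x y a b : Γ.V} {χ : Chain Γ a b} {Ψ : Chain Γ x y} (h : IsSubchain χ Ψ)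
    (t : Fin χ.dim → I) : W.cube χ t ∈ (subW Ψ).mor a b :=
  ⟨WPt.mk χ t, rfl, by rw [WPt.arrows_mk]; exact h⟩

theorem continuous_cube {x y : Γ.V} (c : Chain Γ x y) : Continuous (W.cube c) := by
  refine continuous_quot_mk.comp ?_
  rw [continuous_iff_coinduced_le]
  exact le_iSup (fun c : Chain Γ x y => TopologicalSpace.coinduced (WPt.mk c) inferInstance) c

theorem boundary_mem_skeleton {k : ℕ} (χ : IndecCube Γ k) {t : Fin χ.chain.dim → I}
    (ht : t ∈ cubeBoundary χ.chain.dim) :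
    W.cube χ.chain t ∈ (skeleton Γ (k - 1)).mor χ.src χ.tgt := by
  obtain ⟨i, hi⟩ := ht
  refine .face _ (.inl χ.proper) ⟨χ.chain, t, rfl, ?_⟩
  have hsub : {j | t j ≠ 0 ∧ t j ≠ 1} ⊆ Set.univ \ {i} := by
    rintro j ⟨h0, h1⟩
    refine ⟨trivial, ?_⟩
    rintro rfl
    exact hi.elim h0 h1
  refine (Set.ncard_le_ncard hsub).trans ?_
  rw [Set.ncard_sdiff_singleton_of_mem (Set.mem_univ i), Set.ncard_univ, Nat.card_fin, χ.dim_eq]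

/-- The restriction of a functor on `WΓ'` to one of its cubes, as a map `X ⋊ C[χ] → Y`. -/
def CFunctor.restrictCube {X : Γ.V → PointedSpace.{w}} {x y a b : Γ.V} {Ψ : Chain Γ x y}
    (F : CFunctor X (subW Ψ)) {χ : Chain Γ a b} (h : IsSubchain χ Ψ) :
    HalfSmashMap (X a) (X b) (Fin χ.dim → I) :=
  ⟨⟨fun p => F.map ⟨W.cube χ p.2, cube_mem_subW h p.2⟩ p.1,
    (F.continuous_map a b).comp (f := fun p : X a × (Fin χ.dim → I) =>
      ((p.1, ⟨W.cube χ p.2, cube_mem_subW h p.2⟩) : X a × (subW Ψ).mor a b))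
      (continuous_fst.prodMk (Continuous.subtype_mk ((continuous_cube χ).comp continuous_snd) _))⟩,
    fun _ => F.map_pt _⟩

/-- A choice, for each indecomposable `(k+1)`-cube `C_i = WΓ_i`, of a functor `F_i` on `WΓ_i`
extending the restriction of the given `(k-1)`-realization. -/
structure CubeExtensions {A : InitialData.{u, v, w} Γ} (k : ℕ) (R : Realization A (k - 1)) where
  functor : ∀ C : IndecCube Γ (k + 1), CFunctor A.obj (subW C.chain)
  extend : ∀ C : IndecCube Γ (k + 1), (functor C).Agree R.toFunctor

/-- Two distinct indecomposable `(k+1)`-cubes together with a common `k`-face. -/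
structure CommonFace (Γ : LatticeCat.{u, v}) (k : ℕ) where
  left : IndecCube Γ (k + 1)
  right : IndecCube Γ (k + 1)
  ne : left ≠ right
  face : IndecCube Γ k
  face_left : IsSubchain face.chain left.chain
  face_right : IsSubchain face.chain right.chain

/-- The obstruction sequence of a choice of functors: the family of the difference obstructions on
all common `k`-faces of pairs of indecomposable `(k+1)`-cubes. -/
def CubeExtensions.obstructionSequence {A : InitialData.{u, v, w} Γ} {k : ℕ}
    {R : Realization A (k - 1)} (F : CubeExtensions k R) (p : CommonFace Γ k) :
    DifferenceClass (A.obj p.face.src) (A.obj p.face.tgt) (cubeBoundary p.face.chain.dim) :=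
  differenceObstruction ((F.functor p.left).restrictCube p.face_left)
    ((F.functor p.right).restrictCube p.face_right) (by
      intro s t ht
      have h := boundary_mem_skeleton p.face ht
      exact (congrFun (F.extend p.left _ _ _ (cube_mem_subW p.face_left t) h) s).trans
        (congrFun (F.extend p.right _ _ _ (cube_mem_subW p.face_right t) h) s).symm)

/-- The obstruction sequence vanishes if each of its components is null. -/
def CubeExtensions.Vanishes {A : InitialData.{u, v, w} Γ} {k : ℕ} {R : Realization A (k - 1)}
    (F : CubeExtensions k R) : Prop :=
  ∀ p : CommonFace Γ k, (F.obstructionSequence p).IsNull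

end HHO

end

noncomputable section

open Topology
open scoped unitInterval

namespace HHO

variable {Γ : LatticeCat.{u, v}}

/-! Restriction gives one direction: for an indecomposable `(k+1)`-cube `Ψ` the whole of `WΓ_Ψ` lies
in the `(k+1)`-skeleton (`subW_le_skeleton`). A single functor on that skeleton therefore supplies
every `F_Ψ`, and the difference of a map with itself is null because the double folds onto a
contractible cube.

For the converse let `k = n + 1`. The double of a cube is the boundary sphere of a cylinder over it,
with the sides collapsed, and a map from a sphere that is freely homotopic to a constant extends
over the ball. Null differences thus make `F_Ψ` and `F_Ψ'` homotopic relative to the boundary on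
each common `(n+1)`-face (`exists_cubeHomotopy_of_isNull`). Each indecomposable `(n+1)`-cube
contained in some `Ψ` receives the value of one chosen `F_Ψ₀`; the remaining ones keep the value of
the given `k`-realization. This defines a functor `F₁` on the `(n+1)`-skeleton, possibly different
from the given one. On the boundary of each `(n+2)`-cube `Ψ` it is homotopic to `F_Ψ`, which extends
over `Ψ`; by the homotopy extension property so does `F₁` (`exists_cube_extension`).

Functors are built on two facts. A morphism of `WΓ` is a product of indecomposable ones, cut at the
parameters `1`, so a multiplicative function may be prescribed on indecomposables (`W.blockMap`).
The characteristic maps of the finitely many cubes of `WΓ(x,y)` are proper, so continuity, even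
after a product with a space `X`, can be tested on cubes (`W.continuous_of_cube`). Together they
give the extension over the next cubes (`ExtensionData`, `CFunctor.exists_extension`). -/

/-! ## Combinatorics of points of the W-construction -/

/-- Prefixing a morphism of `WΓ` by an arrow, with parameter `t` at the new node. -/
def W.cons {x y z : Γ.V} (f : Γ.Hom x y) (t : I) : W Γ y z → W Γ x z :=
  Quot.map (WPt.cons f t) fun _ _ h => .tail f t h

theorem W.cons_zero_arrow {x y z : Γ.V} (f : Γ.Hom x y) (g : Γ.Hom y z) :
    W.cons f 0 (W.arrow g) = W.arrow (Γ.comp f g) :=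
  Quot.sound (.last f g)

theorem W.cons_zero_cons {x y z s : Γ.V} (f : Γ.Hom x y) (g : Γ.Hom y z) (t : I) (a : W Γ z s) :
    W.cons f 0 (W.cons g t a) = W.cons (Γ.comp f g) t a := by
  induction a using Quot.ind with
  | mk p => exact Quot.sound (.inner f g t p)

/-- The underlying chain. -/
def WPt.chain : ∀ {x y : Γ.V}, WPt Γ x y → Chain Γ x y
  | _, _, .single f => .single f
  | _, _, .cons f _ p => .cons f p.chain

/-- The parameters at the internal nodes. -/
def WPt.param : ∀ {x y : Γ.V} (p : WPt Γ x y), Fin p.chain.dim → I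
  | _, _, .single _ => Fin.elim0
  | _, _, .cons _ t p => Fin.cons (n := p.chain.dim) (α := fun _ => I) t p.param

theorem WPt.mk_chain_param {x y : Γ.V} (p : WPt Γ x y) : WPt.mk p.chain p.param = p := by
  induction p with
  | single f => rfl
  | cons f t p ih =>
    change WPt.cons f _ (WPt.mk p.chain _) = _
    congr 1

theorem WPt.chain_mk {x y : Γ.V} (c : Chain Γ x y) (t : Fin c.dim → I) :
    (WPt.mk c t).chain = c := by
  induction c with
  | single f => rfl
  | cons f c ih => exact congrArg (Chain.cons f) (ih _)

theorem WPt.mk_injective {x y : Γ.V} (c : Chain Γ x y) : Function.Injective (WPt.mk c) := by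
  induction c with
  | single f => exact fun t t' _ => funext fun i => i.elim0
  | cons f c ih =>
    intro t t' h
    have h' : WPt.cons f (t (0 : Fin (c.dim + 1))) (WPt.mk c (Fin.tail (n := c.dim) t)) =
      WPt.cons f (t' (0 : Fin (c.dim + 1))) (WPt.mk c (Fin.tail (n := c.dim) t')) := h
    injection h' with _ _ _ _ h1 h2
    funext i
    refine Fin.cases (n := c.dim) h1 (fun j => ?_) i
    exact congrFun (ih h2) j

theorem WPt.arrows_chain {x y : Γ.V} (p : WPt Γ x y) : p.chain.arrows = p.arrows := by
  induction p with
  | single f => rfl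
  | cons f t p ih => simp [WPt.chain, Chain.arrows, WPt.arrows, ih]

/-- A function of the chain and the parameters only depends on the point. -/
theorem WPt.apply_chain_param {α : Type*} {x y : Γ.V}
    (G : ∀ c : Chain Γ x y, (Fin c.dim → I) → α) (c : Chain Γ x y) (t : Fin c.dim → I) :
    G (WPt.mk c t).chain (WPt.mk c t).param = G c t := by
  have h := WPt.mk_chain_param (WPt.mk c t)
  generalize (WPt.mk c t).param = s at h
  revert s
  rw [WPt.chain_mk]
  intro s h
  rw [WPt.mk_injective c h]

/-- Some parameter is `1`. -/
def WPt.HasOne : ∀ {x y : Γ.V}, WPt Γ x y → Prop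
  | _, _, .single _ => False
  | _, _, .cons _ t p => t = 1 ∨ p.HasOne

/-- The relation deletes one parameter `0` and keeps all others, so it neither creates nor removes a
`1`. -/
theorem WPt.Rel.hasOne_eq {x y : Γ.V} {p q : WPt Γ x y} (h : WPt.Rel p q) :
    p.HasOne = q.HasOne := by
  induction h with
  | last f g => simp [WPt.HasOne]
  | inner f g t p => simp [WPt.HasOne]
  | tail f t _ ih => simp [WPt.HasOne, ih]

/-- Some parameter is `1`, i.e. the morphism is decomposable. -/
def W.HasOne {x y : Γ.V} : W Γ x y → Prop :=
  Quot.lift WPt.HasOne fun _ _ h => h.hasOne_eq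

theorem WPt.hasOne_append {x y z : Γ.V} (p : WPt Γ x y) (q : WPt Γ y z) :
    (p.append q).HasOne := by
  induction p with
  | single f => exact .inl rfl
  | cons f t p ih => exact .inr (ih q)

theorem W.hasOne_comp {x y z : Γ.V} (a : W Γ x y) (b : W Γ y z) : (a.comp b).HasOne := by
  induction a using Quot.ind with
  | mk p =>
    induction b using Quot.ind with
    | mk q => exact p.hasOne_append q

theorem WPt.HasOne.exists_append {x y : Γ.V} {p : WPt Γ x y} (h : p.HasOne) :
    ∃ (z : Γ.V) (p₁ : WPt Γ x z) (p₂ : WPt Γ z y), p = p₁.append p₂ := by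
  induction p with
  | single f => exact h.elim
  | cons f t p ih =>
    by_cases ht : t = 1
    · exact ⟨_, .single f, p, by rw [ht]; rfl⟩
    · obtain ⟨z, p₁, p₂, rfl⟩ := ih (h.resolve_left ht)
      exact ⟨z, .cons f t p₁, p₂, rfl⟩

theorem WPt.hasOne_mk {x y : Γ.V} (c : Chain Γ x y) (t : Fin c.dim → I) :
    (WPt.mk c t).HasOne ↔ ∃ i, t i = 1 := by
  induction c with
  | single f => exact ⟨False.elim, fun ⟨i, _⟩ => i.elim0⟩
  | cons f c ih =>
    refine Iff.trans ?_ (Fin.exists_fin_succ (n := c.dim)).symm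
    exact or_congr Iff.rfl (ih _)

open scoped Classical in
/-- The number of parameters different from `0` and `1`. -/
def WPt.count : ∀ {x y : Γ.V}, WPt Γ x y → ℕ
  | _, _, .single _ => 0
  | _, _, .cons _ t p => (if t ≠ 0 ∧ t ≠ 1 then 1 else 0) + p.count

theorem WPt.Rel.count_eq {x y : Γ.V} {p q : WPt Γ x y} (h : WPt.Rel p q) :
    p.count = q.count := by
  induction h with
  | last f g => simp [WPt.count]
  | inner f g t p => simp [WPt.count]
  | tail f t _ ih => simp [WPt.count, ih]

/-- The number of parameters different from `0` and `1`. -/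
def W.count {x y : Γ.V} : W Γ x y → ℕ :=
  Quot.lift WPt.count fun _ _ h => h.count_eq

theorem WPt.count_append {x y z : Γ.V} (p : WPt Γ x y) (q : WPt Γ y z) :
    (p.append q).count = p.count + q.count := by
  induction p with
  | single f => simp [WPt.append, WPt.count]
  | cons f t p ih => simp [WPt.append, WPt.count, ih, add_assoc]

theorem W.count_comp {x y z : Γ.V} (a : W Γ x y) (b : W Γ y z) :
    (a.comp b).count = a.count + b.count := by
  induction a using Quot.ind with
  | mk p =>
    induction b using Quot.ind with
    | mk q => exact p.count_append q

open scoped Classical in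
theorem WPt.count_mk {x y : Γ.V} (c : Chain Γ x y) (t : Fin c.dim → I) :
    (WPt.mk c t).count = ∑ i, if t i ≠ 0 ∧ t i ≠ 1 then 1 else 0 := by
  induction c with
  | single f => rfl
  | cons f c ih =>
    refine Eq.trans ?_ (Fin.sum_univ_succ (n := c.dim) _).symm
    exact congrArg _ (ih _)

theorem W.count_cube {x y : Γ.V} (c : Chain Γ x y) (t : Fin c.dim → I) :
    (W.cube c t).count = {i | t i ≠ 0 ∧ t i ≠ 1}.ncard := by
  classical
  rw [Set.ncard_eq_toFinset_card', Set.toFinset_ofPred, Finset.card_filter]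
  exact WPt.count_mk c t

theorem W.exists_cube {x y : Γ.V} (a : W Γ x y) : ∃ c t, a = W.cube c t := by
  induction a using Quot.ind with
  | mk p => exact ⟨p.chain, p.param, by rw [W.cube, p.mk_chain_param]⟩

/-- Deleting zeros does not affect the number of interior coordinates, so the face condition, which
asks for one suitable chain, can be tested on any representative. -/
theorem inFace_iff {k : ℕ} {x y : Γ.V} {a : W Γ x y} : InFace k a ↔ a.count ≤ k := by
  constructor
  · rintro ⟨c, t, rfl, h⟩
    rwa [W.count_cube]
  · intro h
    obtain ⟨c, t, rfl⟩ := a.exists_cube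
    exact ⟨c, t, rfl, by rwa [← W.count_cube]⟩

theorem W.count_cube_le {x y : Γ.V} (c : Chain Γ x y) (t : Fin c.dim → I) :
    (W.cube c t).count ≤ c.dim := by
  rw [W.count_cube]
  exact (Set.ncard_le_card _).trans (by simp)

theorem W.count_cube_of_interior {x y : Γ.V} (c : Chain Γ x y) (t : Fin c.dim → I)
    (h : ∀ i, t i ≠ 0 ∧ t i ≠ 1) : (W.cube c t).count = c.dim := by
  rw [W.count_cube, Set.eq_univ_of_forall (s := {i | t i ≠ 0 ∧ t i ≠ 1}) h, Set.ncard_univ,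
    Nat.card_fin]

theorem W.not_hasOne_cube {x y : Γ.V} (c : Chain Γ x y) (t : Fin c.dim → I)
    (h : ∀ i, t i ≠ 0 ∧ t i ≠ 1) : ¬ (W.cube c t).HasOne := by
  intro h'
  obtain ⟨i, hi⟩ := (WPt.hasOne_mk c t).1 h'
  exact (h i).2 hi

/-! ## Normal forms -/

/-- Composing an arrow with the first arrow of a chain. -/
def WPt.absorb {x y : Γ.V} (f : Γ.Hom x y) : ∀ {z : Γ.V}, WPt Γ y z → WPt Γ x z
  | _, .single g => .single (Γ.comp f g)
  | _, .cons g t p => .cons (Γ.comp f g) t p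

open scoped Classical in
/-- Composing the arrows at all internal nodes with parameter `0`. -/
def WPt.nf : ∀ {x y : Γ.V}, WPt Γ x y → WPt Γ x y
  | _, _, .single f => .single f
  | _, _, .cons f t p => if t = 0 then p.nf.absorb f else .cons f t p.nf

theorem WPt.absorb_absorb {x y z s : Γ.V} (f : Γ.Hom x y) (g : Γ.Hom y z) (p : WPt Γ z s) :
    (p.absorb g).absorb f = p.absorb (Γ.comp f g) := by
  cases p <;> simp [WPt.absorb, Γ.assoc]

/-- Normalisation descends to the quotient; associativity in `Γ` enters only where two consecutive
zeros are collapsed. -/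
theorem WPt.Rel.nf_eq {x y : Γ.V} {p q : WPt Γ x y} (h : WPt.Rel p q) : p.nf = q.nf := by
  induction h with
  | last f g => simp [WPt.nf, WPt.absorb]
  | inner f g t p =>
    by_cases ht : t = 0
    · simp [WPt.nf, ht, WPt.absorb_absorb]
    · simp [WPt.nf, ht, WPt.absorb]
  | tail f t _ ih => simp [WPt.nf, ih]

/-- The normal form of a morphism of `WΓ`. -/
def W.nf {x y : Γ.V} : W Γ x y → WPt Γ x y :=
  Quot.lift WPt.nf fun _ _ h => h.nf_eq

theorem WPt.quot_absorb {x y z : Γ.V} (f : Γ.Hom x y) (p : WPt Γ y z) :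
    (Quot.mk _ (p.absorb f) : W Γ x z) = W.cons f 0 (Quot.mk _ p) := by
  cases p with
  | single g => exact (Quot.sound (.last f g)).symm
  | cons g t p => exact (Quot.sound (.inner f g t p)).symm

theorem WPt.quot_nf {x y : Γ.V} (p : WPt Γ x y) : (Quot.mk _ p.nf : W Γ x y) = Quot.mk _ p := by
  induction p with
  | single f => rfl
  | cons f t p ih =>
    by_cases ht : t = 0
    · simp only [WPt.nf, ht, if_true, WPt.quot_absorb, ih]
      rfl
    · simp only [WPt.nf, ht, if_false]
      exact congrArg (W.cons f t) ih

/-- No parameter is `0`. -/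
def WPt.NoZero : ∀ {x y : Γ.V}, WPt Γ x y → Prop
  | _, _, .single _ => True
  | _, _, .cons _ t p => t ≠ 0 ∧ p.NoZero

theorem WPt.NoZero.absorb {x y z : Γ.V} (f : Γ.Hom x y) {p : WPt Γ y z} (h : p.NoZero) :
    (p.absorb f).NoZero := by
  cases p with
  | single g => trivial
  | cons g t p => exact h

theorem WPt.noZero_nf {x y : Γ.V} (p : WPt Γ x y) : p.nf.NoZero := by
  induction p with
  | single f => trivial
  | cons f t p ih =>
    by_cases ht : t = 0
    · simpa only [WPt.nf, ht, if_true] using ih.absorb f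
    · simpa only [WPt.nf, ht, if_false] using ⟨ht, ih⟩

theorem WPt.NoZero.nf_eq {x y : Γ.V} {p : WPt Γ x y} (h : p.NoZero) : p.nf = p := by
  induction p with
  | single f => rfl
  | cons f t p ih => rw [WPt.nf, if_neg h.1, ih h.2]

theorem WPt.noZero_mk {x y : Γ.V} (c : Chain Γ x y) (t : Fin c.dim → I) :
    (WPt.mk c t).NoZero ↔ ∀ i, t i ≠ 0 := by
  induction c with
  | single f => exact ⟨fun _ i => i.elim0, fun _ => trivial⟩
  | cons f c ih =>
    refine Iff.trans ?_ (Fin.forall_fin_succ (n := c.dim)).symm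
    exact and_congr Iff.rfl (ih _)

theorem W.nf_cube {x y : Γ.V} (c : Chain Γ x y) (t : Fin c.dim → I) (h : ∀ i, t i ≠ 0) :
    (W.cube c t).nf = WPt.mk c t :=
  ((WPt.noZero_mk c t).2 h).nf_eq

/-- Normalising only composes arrows. With `S` the arrows generated by `Ψ`, this keeps the reduction
to interior points inside `WΓ_Ψ`. -/
theorem WPt.arrows_nf (S : ∀ {x y : Γ.V}, Γ.Hom x y → Prop)
    (hS : ∀ {x y z : Γ.V} (f : Γ.Hom x y) (g : Γ.Hom y z), S f → S g → S (Γ.comp f g))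
    {x y : Γ.V} (p : WPt Γ x y) (h : ∀ f ∈ p.arrows, S f.2.2) : ∀ f ∈ p.nf.arrows, S f.2.2 := by
  induction p with
  | single f => exact h
  | cons f t p ih =>
    simp only [WPt.arrows, List.forall_mem_cons] at h
    have ih := ih h.2
    by_cases ht : t = 0
    · simp only [WPt.nf, ht, if_true]
      cases hq : p.nf with
      | single g =>
        rw [hq] at ih
        simp only [WPt.arrows, WPt.absorb, List.forall_mem_cons] at ih ⊢
        exact ⟨hS _ _ h.1 ih.1, ih.2⟩
      | cons g t q =>
        rw [hq] at ih
        simp only [WPt.arrows, WPt.absorb, List.forall_mem_cons] at ih ⊢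
        exact ⟨hS _ _ h.1 ih.1, ih.2⟩
    · simp only [WPt.nf, ht, if_false, WPt.arrows, List.forall_mem_cons]
      exact ⟨h.1, ih⟩

theorem WPt.length_arrows_pos {x y : Γ.V} (p : WPt Γ x y) : 0 < p.arrows.length := by
  cases p <;> simp [WPt.arrows]

/-- Every point of a `W`-construction is a composite of interior points of cubes. -/
theorem WPt.induction_interior (S : ∀ {x y : Γ.V}, Γ.Hom x y → Prop)
    (hS : ∀ {x y z : Γ.V} (f : Γ.Hom x y) (g : Γ.Hom y z), S f → S g → S (Γ.comp f g))
    {P : ∀ {x y : Γ.V}, W Γ x y → Prop}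
    (interior : ∀ {x y : Γ.V} (c : Chain Γ x y) (t : Fin c.dim → I),
      (∀ f ∈ c.arrows, S f.2.2) → (∀ i, t i ≠ 0 ∧ t i ≠ 1) → P (W.cube c t))
    (comp : ∀ {x y z : Γ.V} (a : W Γ x y) (b : W Γ y z), P a → P b → P (a.comp b))
    {x y : Γ.V} (p : WPt Γ x y) (h : ∀ f ∈ p.arrows, S f.2.2) : P (Quot.mk _ p : W Γ x y) := by
  -- A parameter `1` cuts the point into two points with fewer arrows.
  induction hn : p.arrows.length using Nat.strong_induction_on generalizing x y with
  | _ n ih =>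
    by_cases h1 : p.HasOne
    · obtain ⟨z, p₁, p₂, rfl⟩ := h1.exists_append
      rw [WPt.arrows_append] at h hn
      rw [List.length_append] at hn
      have l1 := p₁.length_arrows_pos
      have l2 := p₂.length_arrows_pos
      exact comp _ _
        (ih _ (by omega) p₁ (fun f hf => h f (List.mem_append_left _ hf)) rfl)
        (ih _ (by omega) p₂ (fun f hf => h f (List.mem_append_right _ hf)) rfl)
    -- Normalisation removes the zeros and no `1` is present, so the point is interior to the cube
    -- of its normal form.
    · have e : (Quot.mk _ p : W Γ x y) = W.cube p.nf.chain p.nf.param := by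
        rw [W.cube, WPt.mk_chain_param, WPt.quot_nf]
      have h1' : ¬ (W.cube p.nf.chain p.nf.param).HasOne := e ▸ h1
      rw [e]
      refine interior _ _ ?_ fun i => ⟨?_, fun hi => ?_⟩
      · rw [WPt.arrows_chain]
        exact p.arrows_nf S hS h
      · have := p.noZero_nf
        rw [← p.nf.mk_chain_param] at this
        exact (WPt.noZero_mk _ _).1 this i
      · exact h1' ((WPt.hasOne_mk _ _).2 ⟨i, hi⟩)

theorem W.induction_interior {P : ∀ {x y : Γ.V}, W Γ x y → Prop}
    (interior : ∀ {x y : Γ.V} (c : Chain Γ x y) (t : Fin c.dim → I),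
      (∀ i, t i ≠ 0 ∧ t i ≠ 1) → P (W.cube c t))
    (comp : ∀ {x y z : Γ.V} (a : W Γ x y) (b : W Γ y z), P a → P b → P (a.comp b))
    {x y : Γ.V} (a : W Γ x y) : P a := by
  induction a using Quot.ind with
  | mk p =>
    exact WPt.induction_interior (fun _ => True) (fun _ _ _ _ => trivial)
      (fun c t _ h => interior c t h) comp p fun _ _ => trivial

/-! ## Functions on `WΓ` determined by their values on indecomposable morphisms -/

section Blocks

variable {M : Γ.V → Γ.V → Type w}

/-- The first indecomposable factor of a morphism, and the value of the remaining factors. -/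
inductive BlockSplit (M : Γ.V → Γ.V → Type w) (x y : Γ.V) : Type (max u v w)
  | whole (a : W Γ x y) : BlockSplit M x y
  | split {z : Γ.V} (a : W Γ x z) (r : M z y) : BlockSplit M x y

/-- Prefixing the first factor by an arrow. -/
def BlockSplit.cons {x y z : Γ.V} (f : Γ.Hom x y) (t : I) : BlockSplit M y z → BlockSplit M x z
  | .whole a => .whole (W.cons f t a)
  | .split a r => .split (W.cons f t a) r

variable (mul : ∀ ⦃x y z : Γ.V⦄, M x y → M y z → M x z) (φ : ∀ ⦃x y : Γ.V⦄, W Γ x y → M x y)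

/-- The product of the values of all factors. -/
def BlockSplit.eval {x y : Γ.V} : BlockSplit M x y → M x y
  | .whole a => φ a
  | .split a r => mul (φ a) r

open scoped Classical in
/-- Splitting off the first indecomposable factor. -/
def WPt.blocks : ∀ {x y : Γ.V}, WPt Γ x y → BlockSplit M x y
  | _, _, .single f => .whole (W.arrow f)
  | _, _, .cons f t p =>
    if t = 1 then .split (W.arrow f) (BlockSplit.eval mul φ (WPt.blocks p))
    else BlockSplit.cons f t (WPt.blocks p)

/-- Factors are separated by parameters `1`, while the relation acts at a node with parameter `0`,
hence within a single factor. -/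
theorem WPt.Rel.blocks_eq {x y : Γ.V} {p q : WPt Γ x y} (h : WPt.Rel p q) :
    p.blocks mul φ = q.blocks mul φ := by
  induction h with
  | last f g => simp [WPt.blocks, BlockSplit.cons, W.cons_zero_arrow]
  | inner f g t p =>
    by_cases ht : t = 1
    · simp [WPt.blocks, ht, BlockSplit.cons, W.cons_zero_arrow]
    · cases hp : p.blocks mul φ <;>
        simp [WPt.blocks, ht, hp, BlockSplit.cons, W.cons_zero_cons]
  | tail f t _ ih => simp [WPt.blocks, ih]

/-- The multiplicative function on `WΓ` with values `φ` on indecomposable morphisms. -/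
def W.blockMap {x y : Γ.V} : W Γ x y → M x y :=
  Quot.lift (fun p => (p.blocks mul φ).eval mul φ) fun _ _ h => by rw [h.blocks_eq]

theorem WPt.blocks_append
    (assoc : ∀ {x y z s : Γ.V} (a : M x y) (b : M y z) (c : M z s),
      mul (mul a b) c = mul a (mul b c)) {x y z : Γ.V} (p : WPt Γ x y) (q : WPt Γ y z) :
    (p.append q).blocks mul φ = match p.blocks mul φ with
      | .whole a => .split a ((q.blocks mul φ).eval mul φ)
      | .split a r => .split a (mul r ((q.blocks mul φ).eval mul φ)) := by
  induction p with
  | single f => simp [WPt.append, WPt.blocks]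
  | cons f t p ih =>
    by_cases ht : t = 1
    · simp only [WPt.append, WPt.blocks, ht, if_true, ih q]
      cases p.blocks mul φ <;> simp [BlockSplit.eval, assoc]
    · simp only [WPt.append, WPt.blocks, ht, if_false, ih q]
      cases p.blocks mul φ <;> simp [BlockSplit.cons]

/-- The new node of a concatenation carries a `1`, so the factors of the composite are those of `a`
followed by those of `b`; associativity regroups their values. -/
theorem W.blockMap_comp
    (assoc : ∀ {x y z s : Γ.V} (a : M x y) (b : M y z) (c : M z s),
      mul (mul a b) c = mul a (mul b c)) {x y z : Γ.V} (a : W Γ x y) (b : W Γ y z) :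
    (a.comp b).blockMap mul φ = mul (a.blockMap mul φ) (b.blockMap mul φ) := by
  induction a using Quot.ind with
  | mk p =>
    induction b using Quot.ind with
    | mk q =>
      change ((p.append q).blocks mul φ).eval mul φ =
        mul ((p.blocks mul φ).eval mul φ) ((q.blocks mul φ).eval mul φ)
      rw [WPt.blocks_append mul φ assoc]
      cases p.blocks mul φ <;> simp [BlockSplit.eval, assoc]

theorem W.blockMap_of_not_hasOne {x y : Γ.V} (a : W Γ x y) (h : ¬ a.HasOne) :
    a.blockMap mul φ = φ a := by
  induction a using Quot.ind with
  | mk p =>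
    have : p.blocks mul φ = .whole (Quot.mk _ p) := by
      replace h : ¬ p.HasOne := h
      induction p with
      | single f => rfl
      | cons f t p ih =>
        simp only [WPt.HasOne, not_or] at h
        rw [WPt.blocks, if_neg h.1, ih h.2]
        rfl
    change (p.blocks mul φ).eval mul φ = _
    rw [this]
    rfl

end Blocks

/-! ## Skeleta -/

/-- Such an arrow would close up to a loop with an arrow out of `vinit`. -/
theorem LatticeCat.isEmpty_hom_vinit (x : Γ.V) : IsEmpty (Γ.Hom x Γ.vinit) := by
  refine ⟨fun f => ?_⟩
  by_cases h : x = Γ.vinit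
  · subst h
    exact (Γ.directed _).false f
  · obtain ⟨g⟩ := Γ.weak_initial x h
    exact (Γ.directed _).false (Γ.comp g f)

theorem LatticeCat.isEmpty_hom_vfin (x : Γ.V) : IsEmpty (Γ.Hom Γ.vfin x) := by
  refine ⟨fun f => ?_⟩
  by_cases h : x = Γ.vfin
  · subst h
    exact (Γ.directed _).false f
  · obtain ⟨g⟩ := Γ.weak_terminal x h
    exact (Γ.directed _).false (Γ.comp f g)

/-- The composite of all arrows. -/
def WPt.composite : ∀ {x y : Γ.V}, WPt Γ x y → Γ.Hom x y
  | _, _, .single f => f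
  | _, _, .cons f _ p => Γ.comp f p.composite

theorem W.nonempty_hom {x y : Γ.V} (a : W Γ x y) : Nonempty (Γ.Hom x y) := by
  induction a using Quot.ind with
  | mk p => exact ⟨p.composite⟩

theorem W.target_ne_vinit {x y : Γ.V} (a : W Γ x y) : y ≠ Γ.vinit := by
  rintro rfl
  exact (LatticeCat.isEmpty_hom_vinit x).elim a.nonempty_hom.some

theorem W.source_ne_vfin {x y : Γ.V} (a : W Γ x y) : x ≠ Γ.vfin := by
  rintro rfl
  exact (LatticeCat.isEmpty_hom_vfin y).elim a.nonempty_hom.some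

theorem IsBasic.hasOne {x y : Γ.V} {a : W Γ x y} (h : IsBasic a) :
    ¬ (x = Γ.vinit ∧ y = Γ.vfin) ∨ a.HasOne := by
  refine h.imp_right ?_
  rintro ⟨z, -, -, b, c, rfl⟩
  exact b.hasOne_comp c

/-- A composite always has a parameter `1`, so an indecomposable morphism of the skeleton can only
be one of the generating face points. -/
theorem InSkeleton.of_not_hasOne {k : ℕ} {x y : Γ.V} {a : W Γ x y} (h : InSkeleton k a)
    (h1 : ¬ a.HasOne) : a.count ≤ k ∧ ¬ (x = Γ.vinit ∧ y = Γ.vfin) := by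
  cases h with
  | face _ hb hf => exact ⟨inFace_iff.1 hf, hb.hasOne.resolve_right h1⟩
  | comp a b _ _ => exact (h1 (a.hasOne_comp b)).elim

theorem inSkeleton_of_count_le {k : ℕ} {x y : Γ.V} {a : W Γ x y}
    (h : ¬ (x = Γ.vinit ∧ y = Γ.vfin)) (hk : a.count ≤ k) : InSkeleton k a :=
  .face _ (.inl h) (inFace_iff.2 hk)

theorem InSkeleton.mono {k m : ℕ} (hkm : k ≤ m) {x y : Γ.V} {a : W Γ x y} (h : InSkeleton k a) :
    InSkeleton m a := by
  induction h with
  | face a hb hf => exact .face a hb (inFace_iff.2 ((inFace_iff.1 hf).trans hkm))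
  | comp a b _ _ iha ihb => exact .comp a b iha ihb

/-- All indecomposable factors lie in the `k`-skeleton. -/
def W.AllBlocks (k : ℕ) {x y : Γ.V} (a : W Γ x y) : Prop :=
  a.blockMap (M := fun _ _ => Prop) (fun _ _ _ p q => p ∧ q) (fun _ _ b => InSkeleton k b)

theorem W.allBlocks_comp {k : ℕ} {x y z : Γ.V} (a : W Γ x y) (b : W Γ y z) :
    (a.comp b).AllBlocks k ↔ a.AllBlocks k ∧ b.AllBlocks k :=
  iff_of_eq (W.blockMap_comp _ _ (fun _ _ _ => propext and_assoc) a b)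

theorem W.allBlocks_of_not_hasOne {k : ℕ} {x y : Γ.V} {a : W Γ x y} (h : ¬ a.HasOne) :
    a.AllBlocks k ↔ InSkeleton k a :=
  iff_of_eq (W.blockMap_of_not_hasOne _ _ a h)

theorem inSkeleton_iff_allBlocks {k : ℕ} {x y : Γ.V} {a : W Γ x y} :
    InSkeleton k a ↔ a.AllBlocks k := by
  constructor
  · have face : ∀ {x y : Γ.V} (a : W Γ x y), a.count ≤ k →
        (¬ (x = Γ.vinit ∧ y = Γ.vfin) ∨ a.HasOne) → a.AllBlocks k := by
      intro x y a
      induction a using W.induction_interior with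
      | interior c t h =>
        intro hc hp
        have h1 := W.not_hasOne_cube c t h
        exact (W.allBlocks_of_not_hasOne h1).2
          (inSkeleton_of_count_le (hp.resolve_right h1) hc)
      | comp a b iha ihb =>
        intro hc _
        rw [W.count_comp] at hc
        -- Counts add up, so each factor has count at most `k`. The middle object is neither `vinit`
        -- nor `vfin`, so neither factor runs from `vinit` to `vfin`.
        exact (W.allBlocks_comp a b).2
          ⟨iha (by omega) (.inl fun h => b.source_ne_vfin h.2),
            ihb (by omega) (.inl fun h => a.target_ne_vinit h.1)⟩
    intro h
    induction h with
    | face a hb hf => exact face a (inFace_iff.1 hf) hb.hasOne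
    | comp a b _ _ iha ihb => exact (W.allBlocks_comp a b).2 ⟨iha, ihb⟩
  · induction a using W.induction_interior with
    | interior c t h => exact (W.allBlocks_of_not_hasOne (W.not_hasOne_cube c t h)).1
    | comp a b iha ihb =>
      intro h
      rw [W.allBlocks_comp] at h
      exact .comp a b (iha h.1) (ihb h.2)

/-- Besides composites, the skeleton contains all factors of its morphisms. This permits arguing on
each factor separately on facets with parameter `1`. -/
theorem inSkeleton_comp_iff {k : ℕ} {x y z : Γ.V} {a : W Γ x y} {b : W Γ y z} :
    InSkeleton k (a.comp b) ↔ InSkeleton k a ∧ InSkeleton k b := by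
  simp only [inSkeleton_iff_allBlocks, W.allBlocks_comp]

/-! ## Facets of cubes -/

theorem W.cons_comp {x y z s : Γ.V} (f : Γ.Hom x y) (t : I) (a : W Γ y z) (b : W Γ z s) :
    (W.cons f t a).comp b = W.cons f t (a.comp b) := by
  induction a using Quot.ind with
  | mk p =>
    induction b using Quot.ind with
    | mk q => rfl

/-- A facet on which a parameter is `0` is a cube of smaller dimension. -/
theorem Chain.exists_facet_zero {x y : Γ.V} (c : Chain Γ x y) (i : Fin c.dim) :
    ∃ (c' : Chain Γ x y) (π : Fin c'.dim → Fin c.dim), c'.dim < c.dim ∧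
      ∀ t : Fin c.dim → I, t i = 0 → W.cube c t = W.cube c' (t ∘ π) := by
  induction c with
  | single f => exact i.elim0
  | @cons x y z f c ih =>
    refine Fin.cases (n := c.dim) ?_ (fun j => ?_) i
    · cases c with
      | single g =>
        refine ⟨.single (Γ.comp f g), Fin.elim0, Nat.zero_lt_one, fun t ht => ?_⟩
        exact (congrArg (fun r => W.cons f r (W.arrow g)) ht).trans (W.cons_zero_arrow f g)
      | cons g c =>
        refine ⟨.cons (Γ.comp f g) c, Fin.succ (n := c.dim + 1), Nat.lt_succ_self _,
          fun t ht => ?_⟩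
        exact (congrArg (fun r => W.cons f r (W.cube (.cons g c) (Fin.tail (n := c.dim + 1) t)))
          ht).trans (W.cons_zero_cons f g (Fin.tail (n := c.dim + 1) t 0)
            (W.cube c (Fin.tail (n := c.dim) (Fin.tail (n := c.dim + 1) t))))
    · obtain ⟨c', π, hd, h⟩ := ih j
      refine ⟨.cons f c', Fin.cons (n := c'.dim) (α := fun _ => Fin (c.dim + 1)) 0
        (Fin.succ ∘ π), Nat.succ_lt_succ hd, fun t ht => ?_⟩
      exact congrArg (W.cons f _) (h (Fin.tail (n := c.dim) t) ht)

/-- A facet on which a parameter is `1` is a product of cubes of smaller dimension. -/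
theorem Chain.exists_facet_one {x y : Γ.V} (c : Chain Γ x y) (i : Fin c.dim) :
    ∃ (z : Γ.V) (c₁ : Chain Γ x z) (c₂ : Chain Γ z y) (π₁ : Fin c₁.dim → Fin c.dim)
      (π₂ : Fin c₂.dim → Fin c.dim), c₁.dim < c.dim ∧ c₂.dim < c.dim ∧
      ∀ t : Fin c.dim → I, t i = 1 →
        W.cube c t = (W.cube c₁ (t ∘ π₁)).comp (W.cube c₂ (t ∘ π₂)) := by
  induction c with
  | single f => exact i.elim0
  | @cons x y z f c ih =>
    refine Fin.cases (n := c.dim) ?_ (fun j => ?_) i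
    · refine ⟨y, .single f, c, Fin.elim0, Fin.succ, Nat.succ_pos _, Nat.lt_succ_self _,
        fun t ht => ?_⟩
      exact congrArg (fun r => W.cons f r (W.cube c (Fin.tail (n := c.dim) t))) ht
    · obtain ⟨s, c₁, c₂, π₁, π₂, h₁, h₂, h⟩ := ih j
      refine ⟨s, .cons f c₁, c₂, Fin.cons (n := c₁.dim) (α := fun _ => Fin (c.dim + 1)) 0
        (Fin.succ ∘ π₁), Fin.succ ∘ π₂, Nat.succ_lt_succ h₁, h₂.trans (Nat.lt_succ_self _),
        fun t ht => ?_⟩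
      exact (congrArg (W.cons f _) (h (Fin.tail (n := c.dim) t) ht)).trans
        (W.cons_comp f _ _ _).symm

/-! ## Characteristic maps are proper -/

theorem Chain.finite (x y : Γ.V) : Finite (Chain Γ x y) := by
  have := Γ.finV
  have := Γ.finHom
  -- Reachability is transitive and, since `Γ` is directed, irreflexive, hence well-founded on the
  -- finite set of objects. The induction runs over the source, because removing the first arrow
  -- moves the source forward.
  let r : Γ.V → Γ.V → Prop := fun a b => Nonempty (Γ.Hom b a)
  have : IsTrans Γ.V r := ⟨fun a b c ⟨f⟩ ⟨g⟩ => ⟨Γ.comp g f⟩⟩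
  have : Std.Irrefl r := ⟨fun a ⟨f⟩ => (Γ.directed a).false f⟩
  induction x using (Finite.wellFounded_of_trans_of_irrefl r).induction with
  | _ x ih =>
    have : ∀ p : Σ z, Γ.Hom x z, Finite (Chain Γ p.1 y) := fun p => ih p.1 ⟨p.2⟩
    let e : Γ.Hom x y ⊕ (Σ p : Σ z, Γ.Hom x z, Chain Γ p.1 y) → Chain Γ x y :=
      Sum.elim .single fun q => .cons q.1.2 q.2
    refine Finite.of_surjective e fun c => ?_
    cases c with
    | single f => exact ⟨.inl f, rfl⟩
    | cons f c => exact ⟨.inr ⟨⟨_, f⟩, c⟩, rfl⟩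

/-- If a coordinate is `0`, the pair comes from a facet of smaller dimension. Otherwise both points
are normal forms, and equality means the diagonal when `c = c'` and is impossible when `c ≠ c'`. -/
theorem W.isClosed_cube_eq_cube {x y : Γ.V} (c c' : Chain Γ x y) :
    IsClosed {p : (Fin c.dim → I) × (Fin c'.dim → I) | W.cube c p.1 = W.cube c' p.2} := by
  induction hn : c.dim + c'.dim using Nat.strong_induction_on generalizing c c' with
  | _ n ih =>
    choose d π hd hπ using c.exists_facet_zero
    choose d' π' hd' hπ' using c'.exists_facet_zero
    have hZ : {p : (Fin c.dim → I) × (Fin c'.dim → I) | W.cube c p.1 = W.cube c' p.2} =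
        (⋃ i, {p | p.1 i = 0} ∩
          (fun p => (p.1 ∘ π i, p.2)) ⁻¹' {q | W.cube (d i) q.1 = W.cube c' q.2}) ∪
        (⋃ i, {p | p.2 i = 0} ∩
          (fun p => (p.1, p.2 ∘ π' i)) ⁻¹' {q | W.cube c q.1 = W.cube (d' i) q.2}) ∪
        {p | WPt.mk c p.1 = WPt.mk c' p.2} := by
      ext ⟨t, t'⟩
      simp only [Set.mem_ofPred_eq, Set.mem_union, Set.mem_iUnion, Set.mem_inter_iff,
        Set.mem_preimage]
      constructor
      · intro h
        by_cases h0 : ∃ i, t i = 0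
        · obtain ⟨i, hi⟩ := h0
          exact .inl (.inl ⟨i, hi, by rw [← hπ i t hi, h]⟩)
        by_cases h0' : ∃ i, t' i = 0
        · obtain ⟨i, hi⟩ := h0'
          exact .inl (.inr ⟨i, hi, by rw [← hπ' i t' hi, h]⟩)
        push Not at h0 h0'
        have := congrArg W.nf h
        rw [W.nf_cube c t h0, W.nf_cube c' t' h0'] at this
        exact .inr this
      · rintro ((⟨i, hi, h⟩ | ⟨i, hi, h⟩) | h)
        · rw [hπ i t hi, h]
        · rw [hπ' i t' hi, h]
        · rw [W.cube, h, W.cube]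
    rw [hZ]
    refine ((isClosed_iUnion_of_finite fun i => ?_).union
      (isClosed_iUnion_of_finite fun i => ?_)).union ?_
    · refine (isClosed_eq (by fun_prop) continuous_const).inter (IsClosed.preimage ?_
        (ih _ (by have := hd i; omega) (d i) c' rfl))
      exact Continuous.prodMk (continuous_pi fun j => by dsimp; fun_prop) continuous_snd
    · refine (isClosed_eq (by fun_prop) continuous_const).inter (IsClosed.preimage ?_
        (ih _ (by have := hd' i; omega) c (d' i) rfl))
      exact Continuous.prodMk continuous_fst (continuous_pi fun j => by dsimp; fun_prop)
    · by_cases hc : c = c'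
      · subst hc
        simp only [(WPt.mk_injective c).eq_iff]
        exact isClosed_eq continuous_fst continuous_snd
      · convert isClosed_empty
        rw [Set.eq_empty_iff_forall_notMem]
        intro p hp
        have := congrArg WPt.chain (show WPt.mk c p.1 = WPt.mk c' p.2 from hp)
        rw [WPt.chain_mk, WPt.chain_mk] at this
        exact hc this

theorem W.isClosed_iff {x y : Γ.V} {S : Set (W Γ x y)} :
    IsClosed S ↔ ∀ c : Chain Γ x y, IsClosed (W.cube c ⁻¹' S) := by
  have hq : IsQuotientMap (Quot.mk (WPt.Rel (Γ := Γ) (x := x) (y := y))) :=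
    isQuotientMap_quot_mk
  refine hq.isClosed_preimage.symm.trans ?_
  rw [isClosed_iSup_iff]
  exact forall_congr' fun c => isClosed_coinduced

/-- Both conditions follow from closedness of the coincidence relation in a compact product: images
of closed sets pull back to projections of compact sets, and fibres are slices. Properness, unlike
being a quotient map, survives products with arbitrary spaces. -/
theorem W.isProperMap_cube {x y : Γ.V} (c : Chain Γ x y) : IsProperMap (W.cube c) := by
  refine isProperMap_iff_isClosedMap_and_compact_fibers.2 ⟨continuous_cube c, ?_, fun a => ?_⟩
  · intro S hS
    refine W.isClosed_iff.2 fun c' => ?_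
    have : W.cube c' ⁻¹' (W.cube c '' S) =
        Prod.snd '' ((Prod.fst ⁻¹' S) ∩
          {p : (Fin c.dim → I) × (Fin c'.dim → I) | W.cube c p.1 = W.cube c' p.2}) := by
      ext t'
      constructor
      · rintro ⟨t, ht, h⟩
        exact ⟨(t, t'), ⟨ht, h⟩, rfl⟩
      · rintro ⟨⟨t, t'⟩, ⟨ht, h⟩, rfl⟩
        exact ⟨t, ht, h⟩
    rw [this]
    exact (((hS.preimage continuous_fst).inter
      (W.isClosed_cube_eq_cube c c')).isCompact.image continuous_snd).isClosed
  · obtain ⟨c', t', rfl⟩ := a.exists_cube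
    exact ((W.isClosed_cube_eq_cube c c').preimage
      (Continuous.prodMk continuous_id continuous_const)).isCompact

/-- Continuity of a function on `X × U`, where `U ⊆ WΓ(x,y)`, can be tested on cubes. -/
theorem W.continuous_of_cube {x y : Γ.V} {X Y : Type w} [TopologicalSpace X] [TopologicalSpace Y]
    {U : Set (W Γ x y)} {g : W Γ x y → X → Y}
    (h : ∀ c : Chain Γ x y,
      Continuous fun p : X × (W.cube c ⁻¹' U) => g (W.cube c p.2) p.1) :
    Continuous fun p : X × U => g p.2 p.1 := by
  have := Chain.finite x y
  rw [continuous_iff_isClosed]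
  intro K hK
  -- The preimage is the finite union of the images of the preimages on the cubes, and these images
  -- are taken under closed maps.
  have e : (fun p : X × U => g p.2 p.1) ⁻¹' K =
      ⋃ c : Chain Γ x y, Prod.map id (U.restrictPreimage (W.cube c)) ''
        ((fun p : X × (W.cube c ⁻¹' U) => g (W.cube c p.2) p.1) ⁻¹' K) := by
    ext ⟨s, a, ha⟩
    simp only [Set.mem_preimage, Set.mem_iUnion, Set.mem_image]
    constructor
    · intro hs
      obtain ⟨c, t, rfl⟩ := a.exists_cube
      exact ⟨c, (s, ⟨t, ha⟩), hs, rfl⟩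
    · rintro ⟨c, ⟨s', t, ht⟩, hs, h'⟩
      cases h'
      exact hs
  rw [e]
  exact isClosed_iUnion_of_finite fun c =>
    (isProperMap_id.prodMap ((W.isProperMap_cube c).restrictPreimage U)).isClosedMap _
      (hK.preimage (h c))

/-! ## Extension over the cubes of the next dimension -/

section Extend

variable {X : Γ.V → Type w} (n : ℕ)
  (F : ∀ ⦃x y : Γ.V⦄, W Γ x y → X x → X y)
  (G : ∀ ⦃x y : Γ.V⦄ (c : Chain Γ x y), (Fin c.dim → I) → X x → X y)

open scoped Classical in
/-- The multiplicative function on `WΓ` given by `F` on indecomposable morphisms in the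
`n`-skeleton, and by `G` on the interiors of cubes of higher dimension. -/
def extendMap {x y : Γ.V} (a : W Γ x y) : X x → X y :=
  a.blockMap (M := fun x y => X x → X y) (fun _ _ _ f g => g ∘ f)
    (fun _ _ b => if InSkeleton n b then F b else G b.nf.chain b.nf.param)

theorem extendMap_comp {x y z : Γ.V} (a : W Γ x y) (b : W Γ y z) :
    extendMap n F G (a.comp b) = extendMap n F G b ∘ extendMap n F G a :=
  W.blockMap_comp _ _ (fun _ _ _ => rfl) a b

variable [∀ x, TopologicalSpace (X x)]

/-- `F` is a continuous functor on the `n`-skeleton of `bWΓ`, and `G` extends it over the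
indecomposable `(n+1)`-cubes. -/
structure ExtensionData : Prop where
  continuous_map : ∀ x y : Γ.V,
    Continuous fun p : X x × (skeleton Γ n).mor x y => F (p.2 : W Γ x y) p.1
  map_comp : ∀ {x y z : Γ.V} {a : W Γ x y} {b : W Γ y z}, InSkeleton n a → InSkeleton n b →
    F (a.comp b) = F b ∘ F a
  continuous_cube : ∀ {x y : Γ.V} (c : Chain Γ x y), c.dim = n + 1 →
    ¬ (x = Γ.vinit ∧ y = Γ.vfin) → Continuous fun p : X x × (Fin c.dim → I) => G c p.2 p.1
  cube_eq : ∀ {x y : Γ.V} (c : Chain Γ x y), c.dim = n + 1 → ¬ (x = Γ.vinit ∧ y = Γ.vfin) →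
    ∀ t ∈ cubeBoundary c.dim, G c t = F (W.cube c t)

namespace ExtensionData

variable {n F G}

/-- All factors of `a` lie in the `n`-skeleton, where `F` is multiplicative, so the product of the
values of `F` is the value on the product. -/
theorem extendMap_eq (D : ExtensionData n F G) {x y : Γ.V} (a : W Γ x y)
    (h : InSkeleton n a) : extendMap n F G a = F a := by
  induction a using W.induction_interior with
  | interior c t hi =>
    exact (W.blockMap_of_not_hasOne _ _ _ (W.not_hasOne_cube c t hi)).trans (if_pos h)
  | comp a b iha ihb =>
    rw [inSkeleton_comp_iff] at h
    rw [extendMap_comp, iha h.1, ihb h.2, D.map_comp h.1 h.2]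

theorem extendMap_cube (D : ExtensionData n F G) {x y : Γ.V} (c : Chain Γ x y)
    (hd : c.dim = n + 1)
    (hp : ¬ (x = Γ.vinit ∧ y = Γ.vfin)) (t : Fin c.dim → I) :
    extendMap n F G (W.cube c t) = G c t := by
  by_cases ht : t ∈ cubeBoundary c.dim
  · rw [D.extendMap_eq _ (boundary_mem_skeleton (k := n + 1) ⟨x, y, c, hd, hp⟩ ht),
      D.cube_eq c hd hp t ht]
  · have hi : ∀ i, t i ≠ 0 ∧ t i ≠ 1 := fun i =>
      ⟨fun h => ht ⟨i, .inl h⟩, fun h => ht ⟨i, .inr h⟩⟩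
    have h1 := W.not_hasOne_cube c t hi
    have hn : ¬ InSkeleton n (W.cube c t) := fun h => by
      have := (h.of_not_hasOne h1).1
      rw [W.count_cube_of_interior c t hi] at this
      omega
    refine (W.blockMap_of_not_hasOne _ _ _ h1).trans ((if_neg hn).trans ?_)
    rw [W.nf_cube c t fun i => (hi i).1]
    exact WPt.apply_chain_param (fun c t => G c t) c t

/-- The family `(ρ, θ)` over an arbitrary `T` makes the induction on dimension work: it can be
restricted to closed pieces of `T`, and the value on one factor of a composite can serve as `ρ` for
the next. -/
theorem continuous_extendMap_cube (D : ExtensionData n F G) {x y : Γ.V} (c : Chain Γ x y)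
    {T : Type w} [TopologicalSpace T]
    {ρ : T → X x} (hρ : Continuous ρ) {θ : T → Fin c.dim → I} (hθ : Continuous θ)
    (hmem : ∀ τ, InSkeleton (n + 1) (W.cube c (θ τ))) :
    Continuous fun τ => extendMap n F G (W.cube c (θ τ)) (ρ τ) := by
  induction hn : c.dim using Nat.strong_induction_on generalizing x y c T with
  | _ m ih =>
    by_cases hc : c.dim ≤ n + 1 ∧ ¬ (x = Γ.vinit ∧ y = Γ.vfin)
    · obtain ⟨hd, hp⟩ := hc
      rcases hd.eq_or_lt with hd | hd
      · simp only [D.extendMap_cube c hd hp]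
        exact (D.continuous_cube c hd hp).comp (hρ.prodMk hθ)
      · have hs : ∀ τ, InSkeleton n (W.cube c (θ τ)) := fun τ =>
          inSkeleton_of_count_le hp ((W.count_cube_le c _).trans (Nat.lt_succ_iff.1 hd))
        simp only [fun τ => D.extendMap_eq _ (hs τ)]
        exact (D.continuous_map x y).comp
          (hρ.prodMk (((HHO.continuous_cube c).comp hθ).subtype_mk hs))
    -- An interior point would be indecomposable, and membership in the `(n+1)`-skeleton would then
    -- force the excluded case.
    · have hb : ∀ τ, ∃ i, θ τ i = 0 ∨ θ τ i = 1 := by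
        intro τ
        by_contra hne
        push Not at hne
        have h := (hmem τ).of_not_hasOne (W.not_hasOne_cube c _ hne)
        rw [W.count_cube_of_interior c _ hne] at h
        exact hc h
      have hcl : ∀ (i : Fin c.dim) (r : I), IsClosed {τ | θ τ i = r} := fun i r =>
        isClosed_eq ((continuous_apply i).comp hθ) continuous_const
      -- The family takes values in the facets, so `T` is a finite union of closed sets, on each of
      -- which one coordinate is constantly `0` or `1`.
      refine (locallyFinite_of_finite
        (fun p : Fin c.dim × Bool => {τ | θ τ p.1 = bif p.2 then 1 else 0})).continuous ?_
        (fun p => hcl p.1 _) ?_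
      · refine Set.eq_univ_of_forall fun τ => Set.mem_iUnion.2 ?_
        obtain ⟨i, hi | hi⟩ := hb τ
        · exact ⟨(i, false), hi⟩
        · exact ⟨(i, true), hi⟩
      · rintro ⟨i, _ | _⟩
        · obtain ⟨c', π, hd, h⟩ := c.exists_facet_zero i
          rw [continuousOn_iff_continuous_domRestrict]
          have e : ∀ τ : {τ | θ τ i = 0}, W.cube c (θ τ) = W.cube c' (θ τ ∘ π) := fun τ =>
            h _ τ.2
          have key := ih c'.dim (hn ▸ hd) c' (hρ.comp continuous_subtype_val)
            (θ := fun τ : {τ | θ τ i = 0} => θ τ ∘ π)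
            (continuous_pi fun j => (continuous_apply (π j)).comp
              (hθ.comp continuous_subtype_val))
            (fun τ => e τ ▸ hmem τ) rfl
          refine key.congr fun τ => ?_
          simp only [← e τ, Set.domRestrict_apply, Function.comp_apply]
        · obtain ⟨z, c₁, c₂, π₁, π₂, hd₁, hd₂, h⟩ := c.exists_facet_one i
          rw [continuousOn_iff_continuous_domRestrict]
          have e : ∀ τ : {τ | θ τ i = 1}, W.cube c (θ τ) =
              (W.cube c₁ (θ τ ∘ π₁)).comp (W.cube c₂ (θ τ ∘ π₂)) := fun τ => h _ τ.2
          have hm : ∀ τ : {τ | θ τ i = 1}, InSkeleton (n + 1) (W.cube c₁ (θ τ ∘ π₁)) ∧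
              InSkeleton (n + 1) (W.cube c₂ (θ τ ∘ π₂)) := fun τ =>
            inSkeleton_comp_iff.1 (e τ ▸ hmem τ)
          have key₁ := ih c₁.dim (hn ▸ hd₁) c₁ (hρ.comp continuous_subtype_val)
            (θ := fun τ : {τ | θ τ i = 1} => θ τ ∘ π₁)
            (continuous_pi fun j => (continuous_apply (π₁ j)).comp
              (hθ.comp continuous_subtype_val))
            (fun τ => (hm τ).1) rfl
          -- The output of the first factor, continuous by `key₁`, is the input of the second.
          have key₂ := ih c₂.dim (hn ▸ hd₂) c₂ key₁
            (θ := fun τ : {τ | θ τ i = 1} => θ τ ∘ π₂)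
            (continuous_pi fun j => (continuous_apply (π₂ j)).comp
              (hθ.comp continuous_subtype_val))
            (fun τ => (hm τ).2) rfl
          refine key₂.congr fun τ => ?_
          simp only [Set.domRestrict_apply, e τ, extendMap_comp, Function.comp_apply]

theorem continuous_extendMap (D : ExtensionData n F G) (x y : Γ.V) :
    Continuous fun p : X x × (skeleton Γ (n + 1)).mor x y =>
      extendMap n F G (p.2 : W Γ x y) p.1 :=
  W.continuous_of_cube fun c => D.continuous_extendMap_cube c continuous_fst
    (continuous_subtype_val.comp continuous_snd) fun τ => τ.2.2

end ExtensionData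

end Extend

/-- The value of a functor on a morphism, extended by the trivial map. -/
def CFunctor.total {X : Γ.V → PointedSpace.{w}} {U : Subcat Γ} (F : CFunctor X U) ⦃x y : Γ.V⦄
    (a : W Γ x y) : X x → X y :=
  open scoped Classical in if h : a ∈ U.mor x y then F.map ⟨a, h⟩ else fun _ => (X y).pt

theorem CFunctor.total_eq {X : Γ.V → PointedSpace.{w}} {U : Subcat Γ} (F : CFunctor X U)
    {x y : Γ.V} {a : W Γ x y} (h : a ∈ U.mor x y) : F.total a = F.map ⟨a, h⟩ :=
  dif_pos h

theorem CFunctor.continuous_total {X : Γ.V → PointedSpace.{w}} {U : Subcat Γ} (F : CFunctor X U)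
    (x y : Γ.V) : Continuous fun p : X x × U.mor x y => F.total (p.2 : W Γ x y) p.1 := by
  refine (F.continuous_map x y).congr fun p => ?_
  rw [F.total_eq p.2.2]

theorem CFunctor.total_comp {X : Γ.V → PointedSpace.{w}} {U : Subcat Γ} (F : CFunctor X U)
    {x y z : Γ.V} {a : W Γ x y} {b : W Γ y z} (ha : a ∈ U.mor x y) (hb : b ∈ U.mor y z) :
    F.total (a.comp b) = F.total b ∘ F.total a := by
  rw [F.total_eq ha, F.total_eq hb, F.total_eq (U.comp_mem ha hb)]
  exact funext (F.map_comp ⟨a, ha⟩ ⟨b, hb⟩)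

/-- A functor on the `n`-skeleton extends to the `(n+1)`-skeleton, with prescribed values on
indecomposable `(n+1)`-cubes. -/
theorem CFunctor.exists_extension {X : Γ.V → PointedSpace.{w}} {n : ℕ}
    (F : CFunctor X (skeleton Γ n))
    (G : ∀ C : IndecCube Γ (n + 1), HalfSmashMap (X C.src) (X C.tgt) (Fin C.chain.dim → I))
    (hG : ∀ (C : IndecCube Γ (n + 1)) (s : X C.src), ∀ t ∈ cubeBoundary C.chain.dim,
      (G C).1 (s, t) = F.total (W.cube C.chain t) s) :
    ∃ F' : CFunctor X (skeleton Γ (n + 1)), F'.Agree F ∧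
      ∀ (C : IndecCube Γ (n + 1)) (t : Fin C.chain.dim → I) (s : X C.src),
        F'.total (W.cube C.chain t) s = (G C).1 (s, t) := by
  classical
  -- The default value is never met on the `(n+1)`-skeleton: an indecomposable point there that is
  -- not in the `n`-skeleton is interior to an `(n+1)`-cube not running from `vinit` to `vfin`.
  let G' : ∀ ⦃x y : Γ.V⦄ (c : Chain Γ x y), (Fin c.dim → I) → X x → X y := fun x y c t s =>
    if h : c.dim = n + 1 ∧ ¬ (x = Γ.vinit ∧ y = Γ.vfin) then (G ⟨x, y, c, h.1, h.2⟩).1 (s, t)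
    else (X y).pt
  have hG' : ∀ {x y : Γ.V} (c : Chain Γ x y) (hd : c.dim = n + 1)
      (hp : ¬ (x = Γ.vinit ∧ y = Γ.vfin)) (t s), G' c t s = (G ⟨x, y, c, hd, hp⟩).1 (s, t) :=
    fun c hd hp t s => dif_pos ⟨hd, hp⟩
  have D : ExtensionData (X := fun x => X x) n F.total G' :=
    { continuous_map := F.continuous_total
      map_comp := fun ha hb => F.total_comp ha hb
      continuous_cube := fun c hd hp => by
        simp only [hG' c hd hp]
        exact (G ⟨_, _, c, hd, hp⟩).1.continuous
      cube_eq := fun c hd hp t ht => funext fun s =>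
        (hG' c hd hp t s).trans (hG ⟨_, _, c, hd, hp⟩ s t ht) }
  have hpt : ∀ {x y : Γ.V} (a : W Γ x y), InSkeleton (n + 1) a →
      extendMap (X := fun x => X x) n F.total G' a (X x).pt = (X y).pt := by
    intro x y a
    induction a using W.induction_interior with
    | @interior x y c t hi =>
      intro h
      have h' := h.of_not_hasOne (W.not_hasOne_cube c t hi)
      rw [W.count_cube_of_interior c t hi] at h'
      rcases h'.1.eq_or_lt with hd | hd
      · rw [D.extendMap_cube c hd h'.2, hG' c hd h'.2]
        exact (G ⟨x, y, c, hd, h'.2⟩).2 t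
      · have hs : InSkeleton n (W.cube c t) :=
          inSkeleton_of_count_le h'.2 ((W.count_cube_le c _).trans (Nat.lt_succ_iff.1 hd))
        rw [D.extendMap_eq _ hs, F.total_eq hs]
        exact F.map_pt _
    | comp a b iha ihb =>
      intro h
      rw [inSkeleton_comp_iff] at h
      rw [extendMap_comp, Function.comp_apply, iha h.1, ihb h.2]
  let F' : CFunctor X (skeleton Γ (n + 1)) :=
    { map := fun a => extendMap (X := fun x => X x) n F.total G' a.1
      continuous_map := D.continuous_extendMap
      map_pt := fun a => hpt a.1 a.2
      map_comp := fun a b s => congrFun (extendMap_comp (X := fun x => X x) n F.total G' a.1 b.1) s }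
  refine ⟨F', fun x y a h h' => (D.extendMap_eq a h').trans (F.total_eq h'), fun C t s => ?_⟩
  have hm : W.cube C.chain t ∈ (skeleton Γ (n + 1)).mor C.src C.tgt :=
    inSkeleton_of_count_le C.proper ((W.count_cube_le _ _).trans C.dim_eq.le)
  rw [F'.total_eq hm]
  exact (congrFun (D.extendMap_cube C.chain C.dim_eq C.proper t) s).trans
    (hG' C.chain C.dim_eq C.proper t s)

/-! ## Homotopies on cubes -/

/-- Twice the distance of a point of a cube from the boundary. -/
def cubeMargin {n : ℕ} (t : Fin n → I) : ℝ := 1 - ‖fun i => 2 * (t i : ℝ) - 1‖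

/-- Expansion of a cube from its centre by the factor `1 + 2a`, truncated at the boundary. -/
def cubeExpand {n : ℕ} (a : ℝ) (t : Fin n → I) (i : Fin n) : I :=
  Set.projIcc 0 1 zero_le_one (1 / 2 + (1 + 2 * a) * ((t i : ℝ) - 1 / 2))

theorem continuous_cubeMargin {n : ℕ} : Continuous (cubeMargin (n := n)) := by
  unfold cubeMargin
  fun_prop

theorem continuous_cubeExpand {n : ℕ} :
    Continuous fun p : ℝ × (Fin n → I) => cubeExpand p.1 p.2 := by
  refine continuous_pi fun i => continuous_projIcc.comp ?_
  fun_prop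

theorem cubeExpand_zero {n : ℕ} (t : Fin n → I) : cubeExpand 0 t = t := by
  funext i
  have : (1 / 2 + (1 + 2 * 0) * ((t i : ℝ) - 1 / 2)) = t i := by ring
  rw [cubeExpand, this, Set.projIcc_val]

theorem abs_two_mul_sub_one_le (r : I) : |2 * (r : ℝ) - 1| ≤ 1 := by
  rw [abs_le]
  constructor <;> linarith [r.2.1, r.2.2]

theorem cubeMargin_nonneg {n : ℕ} (t : Fin n → I) : 0 ≤ cubeMargin t :=
  sub_nonneg.2 ((pi_norm_le_iff_of_nonneg zero_le_one).2 fun i => abs_two_mul_sub_one_le (t i))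

theorem cubeMargin_eq_zero {n : ℕ} {t : Fin n → I} (h : t ∈ cubeBoundary n) :
    cubeMargin t = 0 := by
  refine le_antisymm ?_ (cubeMargin_nonneg t)
  obtain ⟨i, hi⟩ := h
  have h1 : ‖2 * (t i : ℝ) - 1‖ = 1 := by
    rcases hi with hi | hi <;> norm_num [hi]
  have h2 := norm_le_pi_norm (fun i => 2 * (t i : ℝ) - 1) i
  rw [cubeMargin]
  linarith

/-- The outer shell of the cube is pushed onto the boundary. The bound `1 / 2` also excludes the
cube of dimension `0`, whose margin is `1`. -/
theorem cubeExpand_margin_mem {n : ℕ} {t : Fin n → I} (h : cubeMargin t ≤ 1 / 2) :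
    cubeExpand (cubeMargin t) t ∈ cubeBoundary n := by
  have h0 := cubeMargin_nonneg t
  have hr : 0 < ‖fun i => 2 * (t i : ℝ) - 1‖ := by
    unfold cubeMargin at h
    linarith
  obtain ⟨i, hi⟩ : ∃ i, ‖fun i => 2 * (t i : ℝ) - 1‖ ≤ ‖2 * (t i : ℝ) - 1‖ := by
    by_contra hne
    push Not at hne
    exact lt_irrefl _ ((pi_norm_lt_iff hr).2 hne)
  have hi' : 1 - cubeMargin t ≤ |2 * (t i : ℝ) - 1| := by
    simpa [cubeMargin] using hi
  generalize cubeMargin t = m at *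
  refine ⟨i, ?_⟩
  unfold cubeExpand
  -- The expansion factor suffices because `(1 + 2m)(1 - m) ≥ 1` for `0 ≤ m ≤ 1/2`.
  rcases le_abs.1 hi' with hi' | hi'
  · right
    exact Set.projIcc_of_right_le _ (by nlinarith)
  · left
    exact Set.projIcc_of_le_left _ (by nlinarith)

/-- A homotopy relative to the boundary between two maps on `X ⋊ I^n`. -/
structure CubeHomotopy (X Y : PointedSpace.{w}) (n : ℕ) where
  toFun : (X × (Fin n → I)) × I → Y
  continuous_toFun : Continuous toFun
  map_pt : ∀ t r, toFun ((X.pt, t), r) = Y.pt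
  stationary : ∀ s, ∀ t ∈ cubeBoundary n, ∀ r, toFun ((s, t), r) = toFun ((s, t), 1)

/-- The constant homotopy. -/
def CubeHomotopy.const {X Y : PointedSpace.{w}} {n : ℕ} (F : HalfSmashMap X Y (Fin n → I)) :
    CubeHomotopy X Y n where
  toFun p := F.1 p.1
  continuous_toFun := F.1.continuous.comp continuous_fst
  map_pt t _ := F.2 t
  stationary _ _ _ _ := rfl

/-- If the difference obstruction of two maps is null, they are homotopic relative to the
boundary. -/
theorem exists_cubeHomotopy_of_isNull {X Y : PointedSpace.{w}} {n : ℕ}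
    (F₁ F₂ : HalfSmashMap X Y (Fin n → I))
    (h : ∀ (s : X), ∀ t ∈ cubeBoundary n, F₁.1 (s, t) = F₂.1 (s, t))
    (hnull : (differenceObstruction F₁ F₂ h).IsNull) :
    ∃ Φ : CubeHomotopy X Y n, (∀ p, Φ.toFun (p, 0) = F₁.1 p) ∧ ∀ p, Φ.toFun (p, 1) = F₂.1 p := by
  obtain ⟨g, ⟨H⟩⟩ := hnull
  -- The tent function vanishes at both ends and is `1` at time `1/2`. The homotopy moves inward
  -- along the nullhomotopy on the first sheet, changes sheet at time `1/2`, and returns along the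
  -- second.
  let u : I → ℝ := fun r => 1 - |2 * (r : ℝ) - 1|
  let q : (X × (Fin n → I)) × I → Fin n → I := fun p =>
    cubeExpand (u p.2 * cubeMargin p.1.2) p.1.2
  let τ : (X × (Fin n → I)) × I → I := fun p =>
    Set.projIcc 0 1 zero_le_one (2 * (u p.2 * cubeMargin p.1.2))
  let K : Bool → (X × (Fin n → I)) × I → Y := fun b p =>
    H (τ p, (p.1.1, Double.mk (cubeBoundary n) (q p, b)))
  have hu : Continuous fun p : (X × (Fin n → I)) × I => u p.2 * cubeMargin p.1.2 :=
    (by fun_prop : Continuous fun p : (X × (Fin n → I)) × I => u p.2).mul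
      (continuous_cubeMargin.comp (continuous_snd.comp continuous_fst))
  have hq : Continuous q :=
    continuous_cubeExpand.comp (hu.prodMk (continuous_snd.comp continuous_fst))
  have hτ : Continuous τ := continuous_projIcc.comp (continuous_const.mul hu)
  have hK : ∀ b, Continuous (K b) := fun b =>
    H.continuous.comp (hτ.prodMk ((continuous_fst.comp continuous_fst).prodMk
      ((Double.isProperMap_mk (isClosed_cubeBoundary n)).continuous.comp
        (hq.prodMk continuous_const))))
  have glue : ∀ c ∈ cubeBoundary n,
      Double.mk (cubeBoundary n) (c, true) = Double.mk (cubeBoundary n) (c, false) :=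
    fun c hc => Quot.sound (.glue c hc)
  have hstart : ∀ b p, u p.2 * cubeMargin p.1.2 = 0 →
      K b p = bif b then F₁.1 p.1 else F₂.1 p.1 := by
    intro b p hp
    have hτ0 : τ p = 0 := by
      simp only [τ, hp, mul_zero]
      exact Set.projIcc_left _
    have hq0 : q p = p.1.2 := by simp only [q, hp, cubeExpand_zero]
    simp only [K, hτ0, hq0]
    exact H.apply_zero _
  -- At the change of sheet, either the margin is at most `1/2` and the expanded point lies on the
  -- common boundary, or the nullhomotopy has reached its constant end.
  have hmid : ∀ p, (p.2 : ℝ) = 1 / 2 → K true p = K false p := by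
    intro p hp
    have hu1 : u p.2 = 1 := by simp [u, hp]
    rcases le_total (cubeMargin p.1.2) (1 / 2) with hm | hm
    · have : q p ∈ cubeBoundary n := by
        simp only [q, hu1, one_mul]
        exact cubeExpand_margin_mem hm
      simp only [K, glue _ this]
    · have hτ1 : τ p = 1 := by
        simp only [τ, hu1, one_mul]
        exact Set.projIcc_of_right_le _ (by linarith)
      simp only [K, hτ1, H.apply_one]
      rfl
  have hKpt : ∀ b t r, K b ((X.pt, t), r) = Y.pt := by
    intro b t r
    refine (H.eq_fst _ (x := (X.pt, _)) rfl).trans ?_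
    exact (differenceMap X Y (isClosed_cubeBoundary n) F₁ F₂ h).2 _
  let Φ : (X × (Fin n → I)) × I → Y := fun p => if (p.2 : ℝ) ≤ 1 / 2 then K true p else K false p
  have hΦ0 : ∀ p, Φ (p, 0) = F₁.1 p := by
    intro p
    have : ((0 : I) : ℝ) ≤ 1 / 2 := by norm_num
    simp only [Φ, this, if_true]
    exact hstart true (p, 0) (by simp [u])
  have hΦ1 : ∀ p, Φ (p, 1) = F₂.1 p := by
    intro p
    have : ¬ ((1 : I) : ℝ) ≤ 1 / 2 := by norm_num
    simp only [Φ, this, if_false]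
    exact hstart false (p, 1) (by norm_num [u])
  refine ⟨⟨Φ, ?_, ?_, ?_⟩, hΦ0, hΦ1⟩
  · exact Continuous.if_le (hK true) (hK false) (by fun_prop) continuous_const hmid
  · intro t r
    simp only [Φ, hKpt, ite_self]
  · intro s t ht r
    have h0 : u r * cubeMargin t = 0 := by rw [cubeMargin_eq_zero ht, mul_zero]
    rw [hΦ1]
    simp only [Φ]
    split_ifs
    · rw [hstart true ((s, t), r) h0]
      exact h s t ht
    · rw [hstart false ((s, t), r) h0]
      rfl

/-- The homotopy extension property of the boundary of a cube. -/
theorem exists_extension_of_boundary_homotopy {X Y : PointedSpace.{w}} {n : ℕ}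
    (F : HalfSmashMap X Y (Fin n → I)) (h : (X × (Fin n → I)) × I → Y)
    (hc : ContinuousOn h {p | p.1.2 ∈ cubeBoundary n})
    (h0 : ∀ s, ∀ t ∈ cubeBoundary n, h ((s, t), 0) = F.1 (s, t))
    (hpt : ∀ t ∈ cubeBoundary n, ∀ r, h ((X.pt, t), r) = Y.pt) :
    ∃ F' : HalfSmashMap X Y (Fin n → I),
      ∀ s, ∀ t ∈ cubeBoundary n, F'.1 (s, t) = h ((s, t), 1) := by
  -- On the shell of margin at most `1/2`, the boundary homotopy runs from time `1` at the boundary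
  -- to time `0` at margin `1/2`; there it meets the expanded copy of `F` on the inner cube.
  let q : X × (Fin n → I) → Fin n → I := fun p => cubeExpand (cubeMargin p.2) p.2
  let τ : X × (Fin n → I) → I := fun p =>
    Set.projIcc 0 1 zero_le_one (1 - 2 * cubeMargin p.2)
  have hm : Continuous fun p : X × (Fin n → I) => cubeMargin p.2 :=
    continuous_cubeMargin.comp continuous_snd
  have hq : Continuous q := continuous_cubeExpand.comp (hm.prodMk continuous_snd)
  have hτ : Continuous τ := continuous_projIcc.comp (by fun_prop)
  have hmem : ∀ p : X × (Fin n → I), cubeMargin p.2 ≤ 1 / 2 → q p ∈ cubeBoundary n :=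
    fun p hp => cubeExpand_margin_mem hp
  let e : X × (Fin n → I) → Y := fun p =>
    if cubeMargin p.2 ≤ 1 / 2 then h ((p.1, q p), τ p) else F.1 (p.1, q p)
  have he : Continuous e := by
    refine continuous_if_le hm continuous_const ?_ ?_ ?_
    · exact hc.comp (f := fun p : X × (Fin n → I) => ((p.1, q p), τ p))
        ((continuous_fst.prodMk hq).prodMk hτ).continuousOn fun p hp => hmem p hp
    · exact (F.1.continuous.comp (continuous_fst.prodMk hq)).continuousOn
    · intro p hp
      have : τ p = 0 := by
        simp only [τ, hp]
        exact Set.projIcc_of_le_left _ (by norm_num)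
      rw [this, h0 _ _ (hmem p hp.le)]
  refine ⟨⟨⟨e, he⟩, fun t => ?_⟩, fun s t ht => ?_⟩
  · change e (X.pt, t) = Y.pt
    simp only [e]
    split_ifs with hle
    · exact hpt _ (hmem (X.pt, t) hle) _
    · exact F.2 _
  · change e (s, t) = _
    have hz := cubeMargin_eq_zero ht
    have h1 : q (s, t) = t := by simp only [q, hz, cubeExpand_zero]
    have h2 : τ (s, t) = 1 := by
      simp only [τ, hz]
      exact Set.projIcc_of_right_le _ (by norm_num)
    simp only [e, hz, h1, h2]
    norm_num

/-- The difference obstruction of a map with itself is null. -/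
theorem differenceObstruction_self_isNull {X Y : PointedSpace.{w}} {n : ℕ}
    (F₁ F₂ : HalfSmashMap X Y (Fin n → I))
    (h : ∀ (s : X), ∀ t ∈ cubeBoundary n, F₁.1 (s, t) = F₂.1 (s, t)) (he : F₁ = F₂) :
    (differenceObstruction F₁ F₂ h).IsNull := by
  subst he
  -- The map factors through the fold onto the cube, which is contracted linearly to the vertex `0`.
  let fold : Double (cubeBoundary n) → Fin n → I := Double.lift Prod.fst fun _ _ => rfl
  have hfold : Continuous fold := continuous_quot_lift _ continuous_fst
  refine ⟨⟨⟨fun s => F₁.1 (s, 0), by fun_prop⟩, F₁.2 0⟩, ⟨⟨⟨⟨fun p =>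
    F₁.1 (p.2.1, fun i => unitInterval.symm p.1 * fold p.2.2 i), ?_⟩, ?_, ?_⟩, ?_⟩⟩⟩
  · refine F₁.1.continuous.comp ((continuous_fst.comp continuous_snd).prodMk
      (continuous_pi fun i => ?_))
    exact (unitInterval.continuous_symm.comp continuous_fst).mul
      ((continuous_apply i).comp (hfold.comp (continuous_snd.comp continuous_snd)))
  · rintro ⟨s, ⟨t, b⟩⟩
    have : (fun i => unitInterval.symm 0 * t i) = t := by simp
    cases b <;> exact congrArg (fun t => F₁.1 (s, t)) this
  · rintro ⟨s, d⟩
    have : (fun i => unitInterval.symm 1 * fold d i) = 0 := by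
      funext i
      simp
    exact congrArg (fun t => F₁.1 (s, t)) this
  · rintro r ⟨s, d⟩ hs
    obtain rfl : s = X.pt := hs
    refine (F₁.2 _).trans ?_
    exact ((differenceMap X Y (isClosed_cubeBoundary n) F₁ F₁ h).2 d).symm

/-! ## Restriction of a realization to the cubes -/

/-- The targets of the arrows of a chain. -/
def Chain.targets {x y : Γ.V} (c : Chain Γ x y) : List Γ.V := c.arrows.map fun f => f.2.1

theorem Chain.length_targets {x y : Γ.V} (c : Chain Γ x y) : c.targets.length = c.dim + 1 := by
  rw [Chain.targets, List.length_map]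
  induction c with
  | single f => rfl
  | cons f c ih => simp [Chain.arrows, Chain.dim, ih]

theorem Chain.nonempty_hom_of_mem_targets {x y z : Γ.V} {c : Chain Γ x y} (h : z ∈ c.targets) :
    Nonempty (Γ.Hom x z) := by
  induction c with
  | single f =>
    obtain rfl : z = _ := by simpa [Chain.targets, Chain.arrows] using h
    exact ⟨f⟩
  | cons f c ih =>
    simp only [Chain.targets, Chain.arrows, List.map_cons, List.mem_cons] at h
    rcases h with rfl | h
    · exact ⟨f⟩
    · exact (ih h).map (Γ.comp f)

theorem Chain.nodup_targets {x y : Γ.V} (c : Chain Γ x y) : c.targets.Nodup := by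
  induction c with
  | single f => simp [Chain.targets, Chain.arrows]
  | cons f c ih =>
    exact List.nodup_cons.2 ⟨fun h => (Γ.directed _).elim
      (Chain.nonempty_hom_of_mem_targets (c := c) h).some, ih⟩

theorem Chain.source_eq_of_mem {x y : Γ.V} {c : Chain Γ x y} {f : Σ a b : Γ.V, Γ.Hom a b}
    (hf : f ∈ c.arrows) : f.1 = x ∨ Nonempty (Γ.Hom x f.1) := by
  induction c with
  | single g =>
    obtain rfl : f = _ := by simpa [Chain.arrows] using hf
    exact .inl rfl
  | cons g c ih =>
    rcases List.mem_cons.1 hf with rfl | hf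
    · exact .inl rfl
    · rcases ih hf with h | h
      · exact .inr (h ▸ ⟨g⟩)
      · exact .inr (h.map (Γ.comp g))

theorem Chain.target_eq_of_mem {x y : Γ.V} {c : Chain Γ x y} {f : Σ a b : Γ.V, Γ.Hom a b}
    (hf : f ∈ c.arrows) : f.2.1 = y ∨ Nonempty (Γ.Hom f.2.1 y) := by
  induction c with
  | single g =>
    obtain rfl : f = _ := by simpa [Chain.arrows] using hf
    exact .inl rfl
  | cons g c ih =>
    rcases List.mem_cons.1 hf with rfl | hf
    · exact .inr (W.cube c 0).nonempty_hom
    · exact ih hf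

theorem Generated.exists_source {x y a b : Γ.V} {Ψ : Chain Γ x y} {f : Γ.Hom a b}
    (h : Generated Ψ f) : ∃ g ∈ Ψ.arrows, g.1 = a := by
  induction h with
  | of f hf => exact ⟨_, hf, rfl⟩
  | comp f g _ _ ih _ => exact ih

theorem Generated.exists_target {x y a b : Γ.V} {Ψ : Chain Γ x y} {f : Γ.Hom a b}
    (h : Generated Ψ f) : ∃ g ∈ Ψ.arrows, g.2.1 = b := by
  induction h with
  | of f hf => exact ⟨_, hf, rfl⟩
  | comp f g _ _ _ ih => exact ih

/-- Targets along a chain are distinct because `Γ` is directed, and a generated arrow ends at the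
target of some arrow of `Ψ`, so counting targets compares the lengths. -/
theorem IsSubchain.dim_le {x y a b : Γ.V} {χ : Chain Γ a b} {Ψ : Chain Γ x y}
    (h : IsSubchain χ Ψ) : χ.dim ≤ Ψ.dim := by
  have hsub : χ.targets ⊆ Ψ.targets := by
    intro z hz
    obtain ⟨f, hf, rfl⟩ := List.mem_map.1 hz
    obtain ⟨g, hg, e⟩ := (h f hf).exists_target
    exact List.mem_map.2 ⟨g, hg, e⟩
  have := (χ.nodup_targets.subperm hsub).length_le
  rw [χ.length_targets, Ψ.length_targets] at this
  omega

theorem Generated.composite {x y a b : Γ.V} {Ψ : Chain Γ x y} (p : WPt Γ a b)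
    (h : ∀ f ∈ p.arrows, Generated Ψ f.2.2) : Generated Ψ p.composite := by
  induction p with
  | single f => exact h _ (List.mem_singleton_self _)
  | cons f t p ih =>
    simp only [WPt.arrows, List.forall_mem_cons] at h
    exact .comp _ _ h.1 (ih h.2)

/-- No arrow enters `vinit` or leaves `vfin`, so a chain having an arrow out of `vinit` and an arrow
into `vfin` starts and ends at these objects. -/
theorem Generated.proper {x y a b : Γ.V} {Ψ : Chain Γ x y} {f : Γ.Hom a b} (h : Generated Ψ f)
    (hΨ : ¬ (x = Γ.vinit ∧ y = Γ.vfin)) : ¬ (a = Γ.vinit ∧ b = Γ.vfin) := by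
  rintro ⟨rfl, rfl⟩
  obtain ⟨g, hg, e⟩ := h.exists_source
  obtain ⟨g', hg', e'⟩ := h.exists_target
  refine hΨ ⟨?_, ?_⟩
  · rcases Chain.source_eq_of_mem hg with h | ⟨⟨k⟩⟩
    · exact h.symm.trans e
    · exact ((LatticeCat.isEmpty_hom_vinit x).false (e ▸ k)).elim
  · rcases Chain.target_eq_of_mem hg' with h | ⟨⟨k⟩⟩
    · exact h.symm.trans e'
    · exact ((LatticeCat.isEmpty_hom_vfin y).false (e' ▸ k)).elim

theorem subW_le_skeleton {n : ℕ} (C : IndecCube Γ n) {a b : Γ.V} {r : W Γ a b}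
    (h : r ∈ (subW C.chain).mor a b) : r ∈ (skeleton Γ n).mor a b := by
  obtain ⟨p, rfl, hp⟩ := h
  refine inSkeleton_of_count_le ((Generated.composite p hp).proper C.proper) ?_
  have hχ : IsSubchain p.chain C.chain := by
    unfold IsSubchain
    rwa [p.arrows_chain]
  have e : (Quot.mk _ p : W Γ a b) = W.cube p.chain p.param := by
    rw [W.cube, p.mk_chain_param]
  rw [e]
  exact (W.count_cube_le _ _).trans (hχ.dim_le.trans C.dim_eq.le)

/-- The restriction of a functor to a smaller subcategory. -/
def CFunctor.restrict {X : Γ.V → PointedSpace.{w}} {U U' : Subcat Γ} (F : CFunctor X U)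
    (h : ∀ {x y : Γ.V} {a : W Γ x y}, a ∈ U'.mor x y → a ∈ U.mor x y) : CFunctor X U' where
  map a := F.map ⟨a.1, h a.2⟩
  continuous_map x y := (F.continuous_map x y).comp (continuous_fst.prodMk
    ((continuous_subtype_val.comp continuous_snd).subtype_mk fun p => h p.2.2))
  map_pt _ := F.map_pt _
  map_comp a b s := F.map_comp ⟨a.1, h a.2⟩ ⟨b.1, h b.2⟩ s

/-- A realization on the next-but-one skeleton gives a vanishing obstruction sequence. -/
theorem exists_vanishing_of_extends {A : InitialData.{u, v, w} Γ} {k : ℕ}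
    {R : Realization A (k - 1)} {R' : Realization A (k + 1)} (h : R'.Extends R) :
    ∃ F : CubeExtensions k R, F.Vanishes := by
  let F : CubeExtensions k R :=
    { functor := fun C => R'.toFunctor.restrict (subW_le_skeleton C)
      extend := fun C x y a ha ha' => h.2 x y a (subW_le_skeleton C ha) ha' }
  exact ⟨F, fun p => differenceObstruction_self_isNull _ _ _ rfl⟩

/-! ## Extension of a realization from a vanishing obstruction sequence -/

theorem cube_mem_skeleton {n : ℕ} (C : IndecCube Γ n) (t : Fin C.chain.dim → I) :
    W.cube C.chain t ∈ (skeleton Γ n).mor C.src C.tgt :=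
  inSkeleton_of_count_le C.proper ((W.count_cube_le _ _).trans C.dim_eq.le)

/-- The restriction of a functor on the `n`-skeleton to an `n`-cube. -/
def CFunctor.restrictSkeleton {X : Γ.V → PointedSpace.{w}} {n : ℕ}
    (F : CFunctor X (skeleton Γ n)) (C : IndecCube Γ n) :
    HalfSmashMap (X C.src) (X C.tgt) (Fin C.chain.dim → I) :=
  ⟨⟨fun p => F.map ⟨W.cube C.chain p.2, cube_mem_skeleton C p.2⟩ p.1,
    (F.continuous_map _ _).comp (continuous_fst.prodMk
      (((continuous_cube C.chain).comp continuous_snd).subtype_mk _))⟩, fun _ => F.map_pt _⟩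

theorem isSubchain_refl {x y : Γ.V} (c : Chain Γ x y) : IsSubchain c c :=
  fun f hf => .of f.2.2 hf

/-- Homotopies on the indecomposable `(n+1)`-cubes relative to the boundary combine to a homotopy on
the boundary of each indecomposable `(n+2)`-cube `Ψ`; hence an extension over `Ψ` of one end of the
homotopy yields an extension of the other end. -/
theorem exists_cube_extension {X : Γ.V → PointedSpace.{w}} {n : ℕ}
    (R : CFunctor X (skeleton Γ n)) (F₁ : CFunctor X (skeleton Γ (n + 1))) (hF₁ : F₁.Agree R)
    (Ψ : IndecCube Γ (n + 2)) (F₀ : CFunctor X (subW Ψ.chain)) (hF₀ : F₀.Agree R)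
    (K : ∀ C : IndecCube Γ (n + 1), CubeHomotopy (X C.src) (X C.tgt) C.chain.dim)
    (hK1 : ∀ C s t, (K C).toFun ((s, t), 1) = F₁.total (W.cube C.chain t) s)
    (hK0 : ∀ C s t, IsSubchain C.chain Ψ.chain →
      (K C).toFun ((s, t), 0) = F₀.total (W.cube C.chain t) s) :
    ∃ H : HalfSmashMap (X Ψ.src) (X Ψ.tgt) (Fin Ψ.chain.dim → I),
      ∀ s, ∀ t ∈ cubeBoundary Ψ.chain.dim, H.1 (s, t) = F₁.total (W.cube Ψ.chain t) s := by
  classical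
  -- Homotopies are treated as maps `X x × I → X y × I` preserving time. Ordinary composition then
  -- composes homotopies at equal times, so the extension over cubes, applied to the spaces `X x ×
  -- I`, glues the `K C` also on facets that are products of cubes.
  let F' : ∀ ⦃x y : Γ.V⦄, W Γ x y → X x × I → X y × I := fun x y a p => (R.total a p.1, p.2)
  let G' : ∀ ⦃x y : Γ.V⦄ (c : Chain Γ x y), (Fin c.dim → I) → X x × I → X y × I :=
    fun x y c t p =>
      if h : c.dim = n + 1 ∧ ¬ (x = Γ.vinit ∧ y = Γ.vfin) then
        ((K ⟨x, y, c, h.1, h.2⟩).toFun ((p.1, t), p.2), p.2)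
      else ((X y).pt, p.2)
  have hG' : ∀ {x y : Γ.V} (c : Chain Γ x y) (hd : c.dim = n + 1)
      (hp : ¬ (x = Γ.vinit ∧ y = Γ.vfin)) (t) (p : X x × I),
      G' c t p = ((K ⟨x, y, c, hd, hp⟩).toFun ((p.1, t), p.2), p.2) :=
    fun c hd hp t s => dif_pos ⟨hd, hp⟩
  have D : ExtensionData (X := fun x => X x × I) n F' G' :=
    { continuous_map := fun x y =>
        ((R.continuous_total x y).comp
          ((continuous_fst.comp continuous_fst).prodMk continuous_snd)).prodMk
          (continuous_snd.comp continuous_fst)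
      map_comp := fun ha hb => by
        funext p
        simp only [F', R.total_comp ha hb, Function.comp_apply]
      continuous_cube := fun c hd hp => by
        simp only [hG' c hd hp]
        exact ((K ⟨_, _, c, hd, hp⟩).continuous_toFun.comp
          (((continuous_fst.comp continuous_fst).prodMk continuous_snd).prodMk
            (continuous_snd.comp continuous_fst))).prodMk (continuous_snd.comp continuous_fst)
      cube_eq := fun {x y} c hd hp t ht => by
        funext p
        have hm : W.cube c t ∈ (skeleton Γ n).mor x y :=
          boundary_mem_skeleton (k := n + 1) ⟨x, y, c, hd, hp⟩ ht
        have hm' : W.cube c t ∈ (skeleton Γ (n + 1)).mor x y := InSkeleton.mono n.le_succ hm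
        have e : F₁.total (W.cube c t) = R.total (W.cube c t) := by
          rw [F₁.total_eq hm', R.total_eq hm, hF₁ x y _ hm' hm]
        rw [hG' c hd hp, (K ⟨x, y, c, hd, hp⟩).stationary _ t ht]
        exact congrArg (·, p.2) ((hK1 ⟨x, y, c, hd, hp⟩ p.1 t).trans (congrFun e p.1)) }
  -- An equation for the homotopy only has to be checked on the `n`-skeleton and on interiors of
  -- `(n+1)`-cubes.
  have check : ∀ {x y : Γ.V} (c : Chain Γ x y) (t : Fin c.dim → I), (∀ i, t i ≠ 0 ∧ t i ≠ 1) →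
      InSkeleton (n + 1) (W.cube c t) → ∀ Q : (X x × I → X y × I) → Prop,
      (InSkeleton n (W.cube c t) → Q (F' (W.cube c t))) →
      (∀ (hd : c.dim = n + 1) (hp : ¬ (x = Γ.vinit ∧ y = Γ.vfin)),
        Q fun p => ((K ⟨x, y, c, hd, hp⟩).toFun ((p.1, t), p.2), p.2)) →
      Q (extendMap (X := fun x => X x × I) n F' G' (W.cube c t)) := by
    intro x y c t hi h Q h₁ h₂
    have h' := h.of_not_hasOne (W.not_hasOne_cube c t hi)
    rw [W.count_cube_of_interior c t hi] at h'
    rcases h'.1.eq_or_lt with hd | hd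
    · rw [D.extendMap_cube c hd h'.2, funext (hG' c hd h'.2 t)]
      exact h₂ hd h'.2
    · have hs : InSkeleton n (W.cube c t) :=
        inSkeleton_of_count_le h'.2 ((W.count_cube_le c _).trans (Nat.lt_succ_iff.1 hd))
      rw [D.extendMap_eq _ hs]
      exact h₁ hs
  have hpt : ∀ {x y : Γ.V} (a : W Γ x y), InSkeleton (n + 1) a → ∀ r,
      extendMap (X := fun x => X x × I) n F' G' a ((X x).pt, r) = ((X y).pt, r) := by
    intro x y a
    induction a using W.induction_interior with
    | interior c t hi =>
      intro h r
      refine check c t hi h (fun f => f (_, r) = (_, r)) (fun hs => ?_) fun hd hp => ?_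
      · simp only [F', R.total_eq hs]
        exact congrArg (·, r) (R.map_pt _)
      · exact congrArg (·, r) ((K ⟨_, _, c, hd, hp⟩).map_pt t r)
    | comp a b iha ihb =>
      intro h r
      rw [inSkeleton_comp_iff] at h
      rw [extendMap_comp, Function.comp_apply, iha h.1, ihb h.2]
  have hone : ∀ {x y : Γ.V} (a : W Γ x y), InSkeleton (n + 1) a → ∀ s,
      extendMap (X := fun x => X x × I) n F' G' a (s, 1) = (F₁.total a s, 1) := by
    intro x y a
    induction a using W.induction_interior with
    | interior c t hi =>
      intro h s
      refine check c t hi h (fun f => f (s, 1) = (_, 1)) (fun hs => ?_) fun hd hp => ?_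
      · simp only [F', R.total_eq hs, F₁.total_eq h, hF₁ _ _ _ h hs]
      · exact congrArg (·, (1 : I)) (hK1 ⟨_, _, c, hd, hp⟩ s t)
    | comp a b iha ihb =>
      intro h s
      rw [inSkeleton_comp_iff] at h
      rw [extendMap_comp, Function.comp_apply, iha h.1, ihb h.2, F₁.total_comp h.1 h.2,
        Function.comp_apply]
  -- Time `0` is controlled only on cubes inside `Γ_Ψ`, hence the restriction on the arrows and the
  -- induction within `WΓ_Ψ`. Membership in `subW` is carried along because `F₀` is multiplicative
  -- only there.
  have hzero : ∀ {x y : Γ.V} (p : WPt Γ x y), (∀ f ∈ p.arrows, Generated Ψ.chain f.2.2) →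
      InSkeleton (n + 1) (Quot.mk _ p : W Γ x y) → ∀ s,
      extendMap (X := fun x => X x × I) n F' G' (Quot.mk _ p : W Γ x y) (s, 0) =
        (F₀.total (Quot.mk _ p : W Γ x y) s, 0) := by
    intro x y p hp
    refine (WPt.induction_interior (fun f => Generated Ψ.chain f) (fun f g => .comp f g)
      (P := fun {x y} a => a ∈ (subW Ψ.chain).mor x y ∧ (InSkeleton (n + 1) a → ∀ s,
        extendMap (X := fun x => X x × I) n F' G' a (s, 0) = (F₀.total a s, 0))) ?_ ?_ p hp).2
    · intro x y c t hc hi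
      have hm : W.cube c t ∈ (subW Ψ.chain).mor x y := cube_mem_subW hc t
      refine ⟨hm, fun h s => ?_⟩
      refine check c t hi h (fun f => f (s, 0) = (_, 0)) (fun hs => ?_) fun hd hp => ?_
      · simp only [F', R.total_eq hs, F₀.total_eq hm, hF₀ _ _ _ hm hs]
      · exact congrArg (·, (0 : I)) (hK0 ⟨_, _, c, hd, hp⟩ s t hc)
    · intro x y z a b iha ihb
      refine ⟨(subW Ψ.chain).comp_mem iha.1 ihb.1, fun h s => ?_⟩
      rw [inSkeleton_comp_iff] at h
      rw [extendMap_comp, Function.comp_apply, iha.2 h.1, ihb.2 h.2, F₀.total_comp iha.1 ihb.1,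
        Function.comp_apply]
  have hmem : ∀ t ∈ cubeBoundary Ψ.chain.dim, InSkeleton (n + 1) (W.cube Ψ.chain t) :=
    fun t ht => boundary_mem_skeleton Ψ ht
  -- At time `0` the boundary homotopy is `F₀`, which is defined on all of `Ψ`; its other end is
  -- `F₁`.
  obtain ⟨H, hH⟩ := exists_extension_of_boundary_homotopy
    (F₀.restrictCube (isSubchain_refl Ψ.chain))
    (fun p => (extendMap (X := fun x => X x × I) n F' G' (W.cube Ψ.chain p.1.2) (p.1.1, p.2)).1)
    (by
      rw [continuousOn_iff_continuous_domRestrict]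
      refine continuous_fst.comp ((D.continuous_extendMap Ψ.src Ψ.tgt).comp
        (f := fun p : {p : (X Ψ.src × (Fin Ψ.chain.dim → I)) × I |
          p.1.2 ∈ cubeBoundary Ψ.chain.dim} => ((p.1.1.1, p.1.2),
            (⟨W.cube Ψ.chain p.1.1.2, hmem _ p.2⟩ : (skeleton Γ (n + 1)).mor _ _))) ?_)
      exact Continuous.prodMk (by fun_prop) (((continuous_cube Ψ.chain).comp
        (continuous_snd.comp (continuous_fst.comp continuous_subtype_val))).subtype_mk _))
    (fun s t ht => by
      have := hzero (WPt.mk Ψ.chain t) (by rw [WPt.arrows_mk]; exact isSubchain_refl _)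
        (hmem t ht) s
      refine (congrArg Prod.fst this).trans ?_
      exact congrFun (F₀.total_eq (cube_mem_subW (isSubchain_refl _) t)) s)
    (fun t ht r => congrArg Prod.fst (hpt _ (hmem t ht) r))
  exact ⟨H, fun s t ht => (hH s t ht).trans (congrArg Prod.fst (hone _ (hmem t ht) s))⟩

/-- A vanishing obstruction sequence of a functor on the `n`-skeleton that extends to the
`(n+1)`-skeleton gives an extension to the `(n+2)`-skeleton. -/
theorem exists_extends_of_vanishing {A : InitialData.{u, v, w} Γ} {n : ℕ}
    {R : Realization A n} {R' : Realization A (n + 1)} (hR' : R'.Extends R)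
    {F : CubeExtensions (k := n + 1) R} (hF : F.Vanishes) :
    ∃ R'' : Realization A (n + 2), R''.Extends R := by
  classical
  have hb : ∀ (χ : IndecCube Γ (n + 1)) {Ψ : IndecCube Γ (n + 2)}
      (h : IsSubchain χ.chain Ψ.chain) (s), ∀ t ∈ cubeBoundary χ.chain.dim,
      ((F.functor Ψ).restrictCube h).1 (s, t) = R.toFunctor.total (W.cube χ.chain t) s := by
    intro χ Ψ h s t ht
    have hm := boundary_mem_skeleton χ ht
    rw [R.toFunctor.total_eq hm]
    exact congrFun (F.extend Ψ _ _ _ (cube_mem_subW h t) hm) s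
  -- One reference value `g` per `(n+1)`-cube, homotopic relative to the boundary to the restriction
  -- of every `F_Ψ` that sees the cube.
  have hg : ∀ χ : IndecCube Γ (n + 1),
      ∃ g : HalfSmashMap (A.obj χ.src) (A.obj χ.tgt) (Fin χ.chain.dim → I),
        (∀ s, ∀ t ∈ cubeBoundary χ.chain.dim,
          g.1 (s, t) = R.toFunctor.total (W.cube χ.chain t) s) ∧
        ∀ (Ψ : IndecCube Γ (n + 2)) (h : IsSubchain χ.chain Ψ.chain),
          ∃ Φ : CubeHomotopy (A.obj χ.src) (A.obj χ.tgt) χ.chain.dim,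
            (∀ p, Φ.toFun (p, 0) = ((F.functor Ψ).restrictCube h).1 p) ∧
            ∀ p, Φ.toFun (p, 1) = g.1 p := by
    intro χ
    by_cases hχ : ∃ Ψ : IndecCube Γ (n + 2), IsSubchain χ.chain Ψ.chain
    · obtain ⟨Ψ₀, h₀⟩ := hχ
      refine ⟨(F.functor Ψ₀).restrictCube h₀, hb χ h₀, fun Ψ h => ?_⟩
      by_cases e : Ψ = Ψ₀
      · subst e
        exact ⟨.const ((F.functor Ψ).restrictCube h), fun _ => rfl, fun _ => rfl⟩
      · exact exists_cubeHomotopy_of_isNull _ _ _ (hF ⟨Ψ, Ψ₀, e, χ, h, h₀⟩)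
    -- A cube in no `Γ_Ψ` gets no value from the `F_Ψ`; a filling of its boundary exists because `R`
    -- extends to a `k`-realization.
    · refine ⟨R'.toFunctor.restrictSkeleton χ, fun s t ht => ?_, fun Ψ h => (hχ ⟨Ψ, h⟩).elim⟩
      have hm := boundary_mem_skeleton χ ht
      rw [R.toFunctor.total_eq hm]
      exact congrFun (hR'.2 _ _ _ (cube_mem_skeleton χ t) hm) s
  choose g hgb hgh using hg
  obtain ⟨F₁, hF₁, hF₁c⟩ := R.toFunctor.exists_extension g hgb
  have hH : ∀ Ψ : IndecCube Γ (n + 2),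
      ∃ H : HalfSmashMap (A.obj Ψ.src) (A.obj Ψ.tgt) (Fin Ψ.chain.dim → I),
        ∀ s, ∀ t ∈ cubeBoundary Ψ.chain.dim,
          H.1 (s, t) = F₁.total (W.cube Ψ.chain t) s := by
    intro Ψ
    -- For fixed `Ψ`, all homotopies end at `g`; those on cubes outside `Γ_Ψ` have no prescribed
    -- start and are taken constant.
    have hK : ∀ C : IndecCube Γ (n + 1),
        ∃ Φ : CubeHomotopy (A.obj C.src) (A.obj C.tgt) C.chain.dim,
          (∀ p, Φ.toFun (p, 1) = (g C).1 p) ∧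
          ∀ h : IsSubchain C.chain Ψ.chain, ∀ p,
            Φ.toFun (p, 0) = ((F.functor Ψ).restrictCube h).1 p := by
      intro C
      by_cases h : IsSubchain C.chain Ψ.chain
      · obtain ⟨Φ, h0, h1⟩ := hgh C Ψ h
        exact ⟨Φ, h1, fun _ => h0⟩
      · exact ⟨.const (g C), fun _ => rfl, fun h' => (h h').elim⟩
    choose K hK1 hK0 using hK
    refine exists_cube_extension R.toFunctor F₁ hF₁ Ψ (F.functor Ψ) (F.extend Ψ) K
      (fun C s t => ?_) fun C s t h => ?_
    · rw [hK1, hF₁c]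
    · rw [hK0 C h, (F.functor Ψ).total_eq (cube_mem_subW h t)]
      rfl
  choose H hHb using hH
  obtain ⟨F₂, hF₂, -⟩ := F₁.exists_extension H hHb
  have hagree : F₂.Agree R.toFunctor := fun x y a h h' =>
    (hF₂ x y a h (InSkeleton.mono n.le_succ h')).trans (hF₁ x y a _ h')
  refine ⟨⟨F₂, fun {x y} h f => ?_⟩, Nat.le_add_right n 2, hagree⟩
  -- Arrows already lie in the `n`-skeleton, where the new functor agrees with `R`, so their
  -- homotopy classes are unchanged.
  refine Eq.trans ?_ (R.class_eq h f)
  refine congrArg _ (Subtype.ext (ContinuousMap.ext fun s => ?_))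
  exact congrFun (hagree x y _ (arrow_mem_skeleton (n + 2) h f) (arrow_mem_skeleton n h f)) s

end HHO

end

theorem theorem3p28 {Γ : HHO.LatticeCat.{u, v}} (A : HHO.InitialData.{u, v, w} Γ)
    (k : ℕ) (hk : 1 ≤ k) (R : HHO.Realization A (k - 1))
    (hR : ∃ R' : HHO.Realization A k, R'.Extends R) :
    (∃ R'' : HHO.Realization A (k + 1), R''.Extends R) ↔
      ∃ F : HHO.CubeExtensions k R, F.Vanishes := by
  constructor
  · rintro ⟨R'', h⟩
    exact HHO.exists_vanishing_of_extends h
  · rintro ⟨F, hF⟩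
    obtain ⟨R', hR'⟩ := hR
    cases k with
    | zero => omega
    | succ n => exact HHO.exists_extends_of_vanishing hR' hF
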